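/- Write $e(t)=e^{2\pi i t}$ and, for a fraction $p/q$ in lowest terms with $q\ge 1$, let $\theta_{p/q}=q^{-1/2}\sum_{n=0}^{q-1}e(pn^2/q)$ be the normalized quadratic Gauss sum. There is an absolute constant $C$ such that the following holds for every irrational $x\in[0,1)$. Let $x=[0;a_1,a_2,\dots]$ be the continued fraction of $x$, and let $p_1/q_1,\ p_2/q_2,\ p_3/q_3,\dots$ be all its convergents in lowest terms, listed in order and beginning with $p_1/q_1=[0]=0/1$, so that $p_2/q_2=[0;a_1]=1/a_1$, and so on. Then the series $$F(x)=\sum_{n=1}^\infty \frac{e(n^2x)}{n}$$ converges (that is, its sequence of partial sums converges) if and only if the series $$\frac12\sum_{j=1}^\infty \frac{\theta_{p_j/q_j}}{\sqrt{q_j}}\,\log\frac{q_{j+1}}{q_j}$$ converges, and in this case the sums of the two series differ by at most $C$ in absolute value. -/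

import Mathlib

open Filter Topology

noncomputable section

/-- The additive character `e(x) = exp (2 π i x)`. -/
def expE (x : ℝ) : ℂ := Complex.exp (2 * Real.pi * Complex.I * x)

/-- The normalized quadratic Gauss sum `θ_{p/q} = q^{-1/2} ∑_{n=0}^{q-1} e(p n² / q)`, where `p/q`
is the fraction `r` in lowest terms, with positive denominator. -/
def gaussTheta (r : ℚ) : ℂ :=
  (1 / (Real.sqrt (r.den : ℝ) : ℂ)) *
    ∑ n ∈ Finset.range r.den, expE ((r.num : ℝ) * (n : ℝ) ^ 2 / (r.den : ℝ))

/-- The denominator of the convergent `[a₀; a₁, …, a_j]` of the continued fraction of `x`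
(in lowest terms). For `j = 0` and `x ∈ [0, 1)` the convergent is `0/1`. -/
def convDen (x : ℝ) (j : ℕ) : ℕ := (x.convergent j).den

/-- The partial sum `∑_{n=1}^{N} e(n² x) / n` of the Fourier series. -/
def fourierPartialSum (x : ℝ) (N : ℕ) : ℂ :=
  ∑ n ∈ Finset.Icc 1 N, expE ((n : ℝ) ^ 2 * x) / (n : ℂ)

/-- The sum over the first `J` convergents `p/q` of `x`, beginning with the integer part
`[a₀] = a₀/1` of `x`, of `(1/2) θ_{p/q} q^{-1/2} log (q'/q)`, where `q'` is the denominator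
of the next convergent. -/
def approxPartialSum (x : ℝ) (J : ℕ) : ℂ :=
  (1 / 2 : ℂ) * ∑ j ∈ Finset.range J,
    gaussTheta (x.convergent j) / (Real.sqrt (convDen x j : ℝ) : ℂ) *
      (Real.log ((convDen x (j + 1) : ℝ) / (convDen x j : ℝ)) : ℂ)

end

/-! Because `1 / n` is the integral of `s^{-1/2} exp(-π n² s)` over `s > 0`, the series `F(x)` is
formally half the integral of `s^{-1/2} (θ(2x + is) - 1)`, where `θ` is Jacobi's theta function.
Cutting this integral at `s = 1/N²` amounts to cutting the series at `n = N`: the discrepancy is a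
sum of `e(n²x)` against monotone weights of size `O(1/N)` at `N` and total mass `O(1)`, and it tends
to `0` by Weyl's bound `∑_{n ≤ N} e(n²x) = o(N)` (`tendsto_fourierPartialSum_sub_thetaTail`).

The integral from `1/N²` to `1` is then cut at the points `1/q_j²`. On the block between
`1/q_{j+1}²` and `1/q_j²`, write `p/q`, `q'` for the convergent and the next denominator, and `h = x
- p/q`. Poisson summation on residue classes mod `q` shows that near the cusp `2p/q` the function
`θ(2p/q + z)` is `θ_{p/q} q^{-1/2} (-iz)^{-1/2}` up to a controlled error
(`norm_jacobiTheta_sub_cusp_le`). At `z = 2h + is` the resulting kernel `s^{-1/2} (s - 2ih)^{-1/2}`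
is close to `1/s` for `s` above `1/(q q')`, which is comparable to `|h|`, and has integral `O(1)`
below. Each block therefore equals `θ_{p/q} q^{-1/2} log(q'/q) + O(q^{-1/2})`
(`norm_integral_thetaPath_sub_log_le`).

Denominators grow at least like Fibonacci numbers, so the errors have a sum bounded by an absolute
constant. This settles the comparison along `N = q_j` and produces `C`. For `N` inside a block the
variation is at most the size of the corresponding term plus `O(q_j^{-1/2})`, which tends to `0`
once the second series converges (`tendsto_of_tendsto_blocks`). -/

/-! ### Denominators of convergents and the quality of approximation -/

open GenContFract in
theorem Irrational.not_terminatedAt_of {x : ℝ} (hx : Irrational x) (n : ℕ) :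
    ¬ (GenContFract.of x).TerminatedAt n := by
  intro h
  obtain ⟨r, hr⟩ := (terminates_iff_rat x).1 ⟨n, h⟩
  exact hx ⟨r, hr.symm⟩

/-- The continuants of the continued fraction of an irrational number are integers. -/
theorem exists_int_contsAux {x : ℝ} (hx : Irrational x) (n : ℕ) :
    (∃ p q : ℤ, (GenContFract.of x).contsAux n = ⟨p, q⟩) ∧
      ∃ p q : ℤ, (GenContFract.of x).contsAux (n + 1) = ⟨p, q⟩ := by
  induction n with
  | zero => exact ⟨⟨1, 0, by simp [GenContFract.contsAux]⟩, ⟨⌊x⌋, 1, by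
      simp [GenContFract.contsAux, GenContFract.of_h_eq_floor]⟩⟩
  | succ n ih =>
    refine ⟨ih.2, ?_⟩
    obtain ⟨⟨p, q, h⟩, p', q', h'⟩ := ih
    obtain ⟨gp, hgp⟩ := Option.ne_none_iff_exists'.1 (hx.not_terminatedAt_of n)
    obtain ⟨ha, z, hz⟩ := GenContFract.of_partNum_eq_one_and_exists_int_partDen_eq hgp
    rw [GenContFract.contsAux_recurrence hgp h h', ha, hz]
    exact ⟨z * p' + 1 * p, z * q' + 1 * q, by push_cast; rfl⟩

theorem fib_succ_le_dens {x : ℝ} (hx : Irrational x) (n : ℕ) :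
    (Nat.fib (n + 1) : ℝ) ≤ (GenContFract.of x).dens n :=
  GenContFract.succ_nth_fib_le_of_nth_den (Or.inr (hx.not_terminatedAt_of _))

theorem dens_pos {x : ℝ} (hx : Irrational x) (n : ℕ) : 0 < (GenContFract.of x).dens n :=
  lt_of_lt_of_le (by exact_mod_cast Nat.fib_pos.2 n.succ_pos) (fib_succ_le_dens hx n)

theorem nums_mul_dens_sub {x : ℝ} (hx : Irrational x) (n : ℕ) :
    (GenContFract.of x).nums n * (GenContFract.of x).dens (n + 1) -
      (GenContFract.of x).dens n * (GenContFract.of x).nums (n + 1) = (-1) ^ (n + 1) :=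
  SimpContFract.determinant (s := SimpContFract.of x) (hx.not_terminatedAt_of n)

/-- The denominator of a convergent in lowest terms is the continuant. -/
theorem convDen_eq_dens {x : ℝ} (hx : Irrational x) (n : ℕ) :
    (convDen x n : ℝ) = (GenContFract.of x).dens n := by
  obtain ⟨-, p, q, h⟩ := exists_int_contsAux hx n
  obtain ⟨-, p', q', h'⟩ := exists_int_contsAux hx (n + 1)
  have hp : (GenContFract.of x).nums n = p := by
    simp [GenContFract.num_eq_conts_a, GenContFract.nth_cont_eq_succ_nth_contAux, h]
  have hq : (GenContFract.of x).dens n = q := by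
    simp [GenContFract.den_eq_conts_b, GenContFract.nth_cont_eq_succ_nth_contAux, h]
  have hp' : (GenContFract.of x).nums (n + 1) = p' := by
    simp [GenContFract.num_eq_conts_a, GenContFract.nth_cont_eq_succ_nth_contAux, h']
  have hq' : (GenContFract.of x).dens (n + 1) = q' := by
    simp [GenContFract.den_eq_conts_b, GenContFract.nth_cont_eq_succ_nth_contAux, h']
  have hdet := nums_mul_dens_sub hx n
  have hpos := dens_pos hx n
  rw [hp, hq, hp', hq'] at hdet
  rw [hq] at hpos ⊢
  have hdet' : p * q' - q * p' = (-1) ^ (n + 1) := by exact_mod_cast hdet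
  have hpos' : 0 < q := by exact_mod_cast hpos
  -- The determinant identity is a Bézout relation, so the continuants are already in lowest terms.
  have hcop : IsCoprime p q := by
    refine ⟨(-1) ^ (n + 1) * q', -((-1) ^ (n + 1) * p'), ?_⟩
    have : ((-1 : ℤ) ^ (n + 1)) * (-1) ^ (n + 1) = 1 := by
      rw [← mul_pow]; norm_num
    linear_combination (-1 : ℤ) ^ (n + 1) * hdet' + this
  have hr : x.convergent n = (p : ℚ) / (q : ℚ) := by
    have := Real.convs_eq_convergent x n
    rw [GenContFract.conv_eq_num_div_den, hp, hq] at this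
    exact_mod_cast this.symm
  have hden : ((x.convergent n).den : ℤ) = q := by
    rw [hr]
    exact Rat.den_div_eq_of_coprime hpos' (Int.isCoprime_iff_nat_coprime.1 hcop)
  rw [convDen]
  exact_mod_cast hden

theorem convDen_zero (x : ℝ) : convDen x 0 = 1 := by
  simp [convDen]

theorem convDen_pos (x : ℝ) (n : ℕ) : 0 < convDen x n := Rat.den_pos _

theorem fib_succ_le_convDen {x : ℝ} (hx : Irrational x) (n : ℕ) :
    Nat.fib (n + 1) ≤ convDen x n := by
  have := fib_succ_le_dens hx n
  rw [← convDen_eq_dens hx] at this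
  exact_mod_cast this

theorem convDen_le_succ {x : ℝ} (hx : Irrational x) (n : ℕ) :
    convDen x n ≤ convDen x (n + 1) := by
  have := GenContFract.of_den_mono (v := x) (n := n)
  rw [← convDen_eq_dens hx, ← convDen_eq_dens hx] at this
  exact_mod_cast this

theorem convDen_add_le {x : ℝ} (hx : Irrational x) (n : ℕ) :
    convDen x n + convDen x (n + 1) ≤ convDen x (n + 2) := by
  obtain ⟨gp, hgp⟩ := Option.ne_none_iff_exists'.1 (hx.not_terminatedAt_of (n + 1))
  obtain ⟨ha, z, hz⟩ := GenContFract.of_partNum_eq_one_and_exists_int_partDen_eq hgp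
  have hb : 1 ≤ gp.b := GenContFract.of_one_le_get?_partDen (GenContFract.partDen_eq_s_b hgp)
  have := GenContFract.dens_recurrence hgp rfl rfl
  rw [← convDen_eq_dens hx, ← convDen_eq_dens hx, ← convDen_eq_dens hx, ha] at this
  have h0 : (0 : ℝ) ≤ convDen x (n + 1) := Nat.cast_nonneg _
  have : ((convDen x n + convDen x (n + 1) : ℕ) : ℝ) ≤ (convDen x (n + 2) : ℕ) := by
    push_cast
    nlinarith
  exact_mod_cast this

theorem abs_sub_convergent_le {x : ℝ} (hx : Irrational x) (n : ℕ) :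
    |x - x.convergent n| ≤ 1 / ((convDen x n : ℝ) * convDen x (n + 1)) := by
  rw [← Real.convs_eq_convergent, convDen_eq_dens hx, convDen_eq_dens hx]
  exact GenContFract.abs_sub_convs_le (hx.not_terminatedAt_of n)

/-- Consecutive convergents are exactly `1/(q q')` apart, while `x` is within `1/(q' (q + q'))` of
the later one; the difference of these is `1/(q (q + q'))`. This keeps the cusp kernel under control
for small `s`. -/
theorem le_abs_sub_convergent {x : ℝ} (hx : Irrational x) (n : ℕ) :
    1 / (2 * ((convDen x n : ℝ) * convDen x (n + 1))) ≤ |x - x.convergent n| := by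
  set q : ℝ := (convDen x n : ℝ) with hq
  set q' : ℝ := (convDen x (n + 1) : ℝ) with hq'
  have hq0 : 0 < q := Nat.cast_pos.2 (convDen_pos x n)
  have hq0' : 0 < q' := Nat.cast_pos.2 (convDen_pos x (n + 1))
  have hle : q ≤ q' := Nat.cast_le.2 (convDen_le_succ hx n)
  have h1 : |((x.convergent n : ℚ) : ℝ) - x.convergent (n + 1)| = 1 / (q * q') := by
    rw [← Real.convs_eq_convergent, ← Real.convs_eq_convergent,
      GenContFract.conv_eq_num_div_den, GenContFract.conv_eq_num_div_den]
    have hdet := nums_mul_dens_sub hx n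
    rw [← convDen_eq_dens hx, ← convDen_eq_dens hx, ← hq, ← hq'] at hdet ⊢
    rw [div_sub_div _ _ hq0.ne' hq0'.ne', hdet, abs_div, abs_neg_one_pow,
      abs_of_pos (mul_pos hq0 hq0')]
  have h2 : |x - x.convergent (n + 1)| ≤ 1 / (q' * (q + q')) := by
    refine (abs_sub_convergent_le hx (n + 1)).trans ?_
    have := convDen_add_le hx n
    have : q + q' ≤ convDen x (n + 2) := by rw [hq, hq']; exact_mod_cast this
    gcongr
  have h3 : |((x.convergent n : ℚ) : ℝ) - x.convergent (n + 1)| ≤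
      |x - x.convergent n| + |x - x.convergent (n + 1)| := by
    rw [abs_sub_comm x (x.convergent n : ℝ)]
    exact abs_sub_le _ _ _
  have h4 : 1 / (q * q') - 1 / (q' * (q + q')) = 1 / (q * (q + q')) := by
    field_simp
    ring
  have h5 : 1 / (2 * (q * q')) ≤ 1 / (q * (q + q')) := by
    apply one_div_le_one_div_of_le (by positivity)
    nlinarith
  linarith

/-- The base `3/2` works because `(3/2)² ≤ 3/2 + 1`; the factor `1/2` covers the initial values. -/
theorem pow_le_fib_succ (n : ℕ) : (3 / 2 : ℝ) ^ n / 2 ≤ Nat.fib (n + 1) := by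
  induction n using Nat.twoStepInduction with
  | zero => norm_num
  | one => norm_num
  | more n h1 h2 =>
    rw [Nat.fib_add_two (n := n + 1)]
    push_cast
    have : (0 : ℝ) < (3 / 2) ^ n := by positivity
    rw [pow_succ] at h2
    rw [pow_succ, pow_succ]
    linarith

theorem summable_inv_sqrt_fib_succ : Summable fun n : ℕ ↦ (√(Nat.fib (n + 1) : ℝ))⁻¹ := by
  have hr : √(2 / 3 : ℝ) < 1 := by
    rw [Real.sqrt_lt' one_pos]; norm_num
  refine Summable.of_nonneg_of_le (fun n ↦ by positivity) (fun n ↦ ?_)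
    ((summable_geometric_of_lt_one (Real.sqrt_nonneg _) hr).mul_left (√2))
  have h := pow_le_fib_succ n
  rw [← Real.sqrt_inv, Real.sqrt_le_iff]
  refine ⟨by positivity, ?_⟩
  rw [mul_pow, Real.sq_sqrt (by norm_num), ← pow_mul, mul_comm n, pow_mul,
    Real.sq_sqrt (by norm_num)]
  have h1 : (2 : ℝ) * (2 / 3) ^ n = ((3 / 2) ^ n / 2)⁻¹ := by
    rw [inv_div, ← inv_div (3 : ℝ) 2, inv_pow]; rfl
  rw [h1]
  gcongr

/-! ### Quadratic Gauss sums -/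

open Finset in
theorem card_two_mul_eq_zero_le (q : ℕ) [NeZero q] :
    #{d : ZMod q | 2 * d = 0} ≤ 2 := by
  refine (card_le_card (t := {0, ((q / 2 : ℕ) : ZMod q)}) fun d hd ↦ ?_).trans card_le_two
  simp only [mem_filter, mem_univ, true_and] at hd
  have h1 : ((2 * d.val : ℕ) : ZMod q) = 0 := by
    push_cast
    rw [ZMod.natCast_zmod_val, hd]
  rw [ZMod.natCast_eq_zero_iff] at h1
  obtain ⟨c, hc⟩ := h1
  have hlt := ZMod.val_lt d
  have hc2 : c < 2 := by
    by_contra! h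
    nlinarith
  simp only [mem_insert, mem_singleton]
  interval_cases c
  · left
    rw [← ZMod.val_eq_zero]
    omega
  · right
    rw [← ZMod.natCast_zmod_val d]
    congr 1
    omega

/-- The quadratic exponential sum `∑_{r mod q} e((p r² + k r) / q)`. -/
noncomputable def quadSum (q : ℕ) (p k : ℤ) : ℂ :=
  ∑ r ∈ Finset.range q, Complex.exp (2 * Real.pi * Complex.I * (p * r ^ 2 + k * r) / q)

theorem quadSum_eq_sum_zmod (q : ℕ) [NeZero q] (p k : ℤ) :
    quadSum q p k = ∑ a : ZMod q, ZMod.stdAddChar ((p : ZMod q) * a ^ 2 + (k : ZMod q) * a) := by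
  refine Finset.sum_bij' (fun r _ ↦ (r : ZMod q)) (fun a _ ↦ a.val) (by simp)
    (fun a _ ↦ by simpa using ZMod.val_lt a)
    (fun r hr ↦ ZMod.val_natCast_of_lt (Finset.mem_range.1 hr)) (fun a _ ↦ by simp)
    (fun r _ ↦ ?_)
  have := ZMod.stdAddChar_coe (N := q) (p * (r : ℤ) ^ 2 + k * r)
  push_cast at this
  rw [this]

-- Squaring and substituting `a = b + d` makes the phase linear in `b`, so the sum over `b` vanishes
-- unless `2pd = 0`, that is `2d = 0` since `p` is a unit. At most two such `d` remain, each
-- contributing `q` in absolute value.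
open Finset in
theorem norm_quadSum_le (q : ℕ) [NeZero q] {p : ℤ} (hp : IsCoprime p (q : ℤ)) (k : ℤ) :
    ‖quadSum q p k‖ ≤ √(2 * q) := by
  set f : ZMod q → ZMod q := fun a ↦ (p : ZMod q) * a ^ 2 + (k : ZMod q) * a with hf
  have hunit : IsUnit (p : ZMod q) := by
    obtain ⟨u, v, h⟩ := hp
    refine IsUnit.of_mul_eq_one (u : ZMod q) ?_
    have := congrArg (Int.cast : ℤ → ZMod q) h
    push_cast at this
    rw [ZMod.natCast_self, mul_zero, add_zero] at this
    rw [mul_comm, this]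
  have hS : quadSum q p k * (starRingEnd ℂ) (quadSum q p k) =
      ∑ d : ZMod q, ZMod.stdAddChar (f d) *
        ((if 2 * (p : ZMod q) * d = 0 then Fintype.card (ZMod q) else 0 : ℕ) : ℂ) := by
    rw [quadSum_eq_sum_zmod, map_sum, sum_mul_sum, sum_comm]
    calc ∑ b, ∑ a, ZMod.stdAddChar (f a) * (starRingEnd ℂ) (ZMod.stdAddChar (f b))
        = ∑ b, ∑ d, ZMod.stdAddChar (f d) * ZMod.stdAddChar (b * (2 * (p : ZMod q) * d)) := by
          refine sum_congr rfl fun b _ ↦ ?_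
          rw [← Equiv.sum_comp (Equiv.addLeft b)]
          refine sum_congr rfl fun d _ ↦ ?_
          rw [← AddChar.map_neg_eq_conj, ← AddChar.map_add_eq_mul, ← AddChar.map_add_eq_mul]
          congr 1
          simp only [hf, Equiv.coe_addLeft]
          ring
      _ = _ := by
          rw [sum_comm]
          refine sum_congr rfl fun d _ ↦ ?_
          rw [← mul_sum, AddChar.sum_mulShift _ (ZMod.isPrimitive_stdAddChar q)]
  have hsq : ‖quadSum q p k‖ ^ 2 ≤ 2 * q := by
    have h1 : ‖quadSum q p k * (starRingEnd ℂ) (quadSum q p k)‖ = ‖quadSum q p k‖ ^ 2 := by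
      rw [norm_mul, RCLike.norm_conj, sq]
    rw [← h1, hS]
    calc _ ≤ ∑ d : ZMod q, if 2 * d = 0 then (q : ℝ) else 0 := by
          refine norm_sum_le_of_le _ fun d _ ↦ ?_
          rw [norm_mul, AddChar.norm_apply, one_mul, Complex.norm_natCast, ZMod.card]
          have : 2 * (p : ZMod q) * d = 0 ↔ 2 * d = 0 := by
            rw [mul_comm (2 : ZMod q), mul_assoc, hunit.mul_right_eq_zero]
          simp only [this]
          split_ifs <;> simp
      _ = #{d : ZMod q | 2 * d = 0} * (q : ℝ) := by
          rw [← sum_filter, sum_const, nsmul_eq_mul]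
      _ ≤ 2 * q := by
          gcongr
          exact_mod_cast card_two_mul_eq_zero_le q
  exact Real.le_sqrt_of_sq_le hsq

theorem gaussTheta_eq_quadSum (r : ℚ) :
    gaussTheta r = quadSum r.den r.num 0 / (√(r.den : ℝ) : ℂ) := by
  rw [gaussTheta, quadSum, one_div, inv_mul_eq_div]
  congr 1
  refine Finset.sum_congr rfl fun n _ ↦ ?_
  rw [expE]
  congr 1
  push_cast
  ring

theorem isCoprime_num_den (r : ℚ) : IsCoprime r.num (r.den : ℤ) :=
  Int.isCoprime_iff_nat_coprime.2 r.reduced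

theorem norm_gaussTheta_le (r : ℚ) : ‖gaussTheta r‖ ≤ √2 := by
  have : NeZero r.den := ⟨r.den_ne_zero⟩
  have h := norm_quadSum_le r.den (isCoprime_num_den r) 0
  have hq : 0 < √(r.den : ℝ) := Real.sqrt_pos.2 (by exact_mod_cast r.den_pos)
  rw [gaussTheta_eq_quadSum, norm_div, Complex.norm_real, Real.norm_of_nonneg hq.le,
    div_le_iff₀ hq, ← Real.sqrt_mul (by norm_num)]
  exact h

/-! ### The theta function near a rational cusp -/

theorem HasSum.of_forall_eq {ι : Type*} {f g : ι → ℂ} {a : ℂ} (h : HasSum g a)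
    (e : ∀ k, f k = g k) : HasSum f a := (funext e : f = g) ▸ h

theorem hasSum_int_inv_sq : HasSum (fun k : ℤ ↦ 1 / (k : ℝ) ^ 2) (Real.pi ^ 2 / 3) := by
  set f : ℤ → ℝ := fun k ↦ 1 / (k : ℝ) ^ 2 with hf
  have h1 : HasSum (fun n : ℕ ↦ f n) (Real.pi ^ 2 / 6) := by
    simpa [hf] using hasSum_zeta_two
  have h2 : HasSum (fun n : ℕ ↦ f (-(n : ℤ))) (Real.pi ^ 2 / 6) := by
    simpa [hf] using hasSum_zeta_two
  have := HasSum.of_nat_of_neg h1 h2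
  have e : Real.pi ^ 2 / 6 + Real.pi ^ 2 / 6 - f 0 = Real.pi ^ 2 / 3 := by
    simp only [hf]
    rw [Int.cast_zero, zero_pow two_ne_zero, div_zero]
    ring
  rwa [e] at this

theorem sq_mul_cpow_half {a : ℝ} (ha : 0 < a) {w : ℂ} (hw : w ≠ 0) :
    ((a : ℂ) ^ 2 * w) ^ (1 / 2 : ℂ) = a * w ^ (1 / 2 : ℂ) := by
  have ha' : (a : ℂ) ≠ 0 := Complex.ofReal_ne_zero.2 ha.ne'
  rw [Complex.cpow_def_of_ne_zero (mul_ne_zero (pow_ne_zero 2 ha') hw),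
    Complex.cpow_def_of_ne_zero hw, ← Complex.ofReal_pow, Complex.log_ofReal_mul (by positivity) hw,
    Real.log_pow, add_mul, Complex.exp_add]
  congr 1
  rw [show ((((2 : ℕ) : ℝ) * Real.log a : ℝ) : ℂ) * (1 / 2) = (Real.log a : ℝ) by push_cast; ring,
    ← Complex.ofReal_exp, Real.exp_log ha]

theorem norm_cpow_half (w : ℂ) : ‖w ^ (1 / 2 : ℂ)‖ = √‖w‖ := by
  rw [Real.sqrt_eq_rpow, ← Complex.norm_cpow_real]
  norm_num

theorem exp_neg_le_inv {u : ℝ} (hu : 0 < u) : Real.exp (-u) ≤ 1 / u := by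
  rw [Real.exp_neg, ← one_div]
  exact one_div_le_one_div_of_le hu (by linarith [Real.add_one_le_exp u])

/-- Splitting the theta series at `2 p / q + z` into residue classes mod `q` and applying Poisson
summation on each class. -/
theorem hasSum_jacobiTheta_cusp (q : ℕ) [NeZero q] (p : ℤ) {z : ℂ} (hz : 0 < z.im) :
    HasSum (fun k : ℤ ↦ 1 / (-Complex.I * (q ^ 2 * z)) ^ (1 / 2 : ℂ) *
        (quadSum q p k * Complex.exp (Real.pi * Complex.I * k ^ 2 * (-1 / (q ^ 2 * z)))))
      (jacobiTheta (2 * (p / q) + z)) := by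
  have hq : (q : ℂ) ≠ 0 := Nat.cast_ne_zero.2 (NeZero.ne q)
  have hqpos : (0 : ℝ) < q := Nat.cast_pos.2 (Nat.pos_of_ne_zero (NeZero.ne q))
  have hz0 : z ≠ 0 := by rintro rfl; simp at hz
  have hqz : 0 < ((q : ℂ) ^ 2 * z).im := by
    have : ((q : ℂ) ^ 2 * z).im = (q : ℝ) ^ 2 * z.im := by
      rw [← Complex.ofReal_natCast, ← Complex.ofReal_pow, Complex.im_ofReal_mul]
    rw [this]; positivity
  have hτ' : 0 < (-1 / ((q : ℂ) ^ 2 * z)).im := by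
    rw [neg_div, Complex.neg_im, one_div, Complex.inv_im, neg_div, neg_neg]
    exact div_pos hqz (Complex.normSq_pos.2 (mul_ne_zero (pow_ne_zero 2 hq) hz0))
  have hτ : 0 < (2 * ((p : ℂ) / q) + z).im := by
    have : (2 * ((p : ℂ) / q) + z).im = z.im := by
      have : (2 * ((p : ℂ) / q)) = ((2 * (p / q) : ℝ) : ℂ) := by push_cast; ring
      rw [Complex.add_im, this, Complex.ofReal_im, zero_add]
    rwa [this]
  set pref : ℂ := 1 / (-Complex.I * (q ^ 2 * z)) ^ (1 / 2 : ℂ) with hpref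
  set c : Fin q → ℂ := fun r ↦ pref *
    (Complex.exp (2 * Real.pi * Complex.I * (p * (r : ℕ) ^ 2) / q) *
      jacobiTheta₂ ((r : ℕ) / q) (-1 / (q ^ 2 * z))) with hc
  have hθ : jacobiTheta (2 * (p / q) + z) = ∑ r, c r := by
    have h1 := hasSum_jacobiTheta₂_term 0 hτ
    rw [← jacobiTheta_eq_jacobiTheta₂, ← (Int.divModEquiv q).symm.hasSum_iff,
      ← (Equiv.prodComm (Fin q) ℤ).hasSum_iff] at h1
    refine (HasSum.prod_fiberwise h1 (g := c) fun r ↦ ?_).unique (hasSum_fintype c)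
    have h2 := (hasSum_jacobiTheta₂_term ((r : ℕ) * q * z) hqz).mul_left
      (Complex.exp (2 * Real.pi * Complex.I * (p * (r : ℕ) ^ 2) / q) *
        Complex.exp (Real.pi * Complex.I * (r : ℕ) ^ 2 * z))
    suffices e0 : c r = Complex.exp (2 * Real.pi * Complex.I * (p * (r : ℕ) ^ 2) / q) *
        Complex.exp (Real.pi * Complex.I * (r : ℕ) ^ 2 * z) *
        jacobiTheta₂ ((r : ℕ) * q * z) (q ^ 2 * z) by
      rw [e0]
      refine h2.of_forall_eq fun m ↦ ?_
      simp only [Function.comp, Equiv.prodComm_apply, Prod.swap, Int.divModEquiv_symm_apply,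
        jacobiTheta₂_term]
      rw [← Complex.exp_add, ← Complex.exp_add, Complex.exp_eq_exp_iff_exists_int]
      refine ⟨p * (m ^ 2 * q + 2 * m * (r : ℕ)), ?_⟩
      push_cast
      field_simp
      ring
    -- The Gaussian factor of the functional equation at argument `r q z` and modulus `q² z` cancels
    -- `exp(π i r² z)`.
    · rw [jacobiTheta₂_functional_equation, hc]
      simp only
      rw [← hpref]
      have e1 : ((r : ℕ) : ℂ) * q * z / (q ^ 2 * z) = (r : ℕ) / q := by
        field_simp
      have e2 : Complex.exp (Real.pi * Complex.I * (r : ℕ) ^ 2 * z) *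
          Complex.exp (-Real.pi * Complex.I * (((r : ℕ) : ℂ) * q * z) ^ 2 / (q ^ 2 * z)) = 1 := by
        rw [← Complex.exp_add, Complex.exp_eq_one_iff]
        refine ⟨0, ?_⟩
        field_simp
        simp
      rw [e1]
      linear_combination (-pref * Complex.exp (2 * Real.pi * Complex.I * (p * (r : ℕ) ^ 2) / q) *
        jacobiTheta₂ ((r : ℕ) / q) (-1 / (q ^ 2 * z))) * e2
  rw [hθ]
  -- Summing over the residues `r` inside the dual sum over `k` assembles the quadratic sums.
  have h3 : HasSum (fun k : ℤ ↦ ∑ r : Fin q, pref *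
      (Complex.exp (2 * Real.pi * Complex.I * (p * (r : ℕ) ^ 2) / q) *
        jacobiTheta₂_term k ((r : ℕ) / q) (-1 / (q ^ 2 * z)))) (∑ r, c r) :=
    hasSum_sum fun r _ ↦ ((hasSum_jacobiTheta₂_term _ hτ').mul_left _).mul_left _
  refine h3.of_forall_eq fun k ↦ ?_
  rw [← Finset.mul_sum, quadSum, Finset.sum_range, Finset.sum_mul]
  congr 1
  refine Finset.sum_congr rfl fun r _ ↦ ?_
  rw [jacobiTheta₂_term, ← Complex.exp_add, ← Complex.exp_add]
  congr 1
  field_simp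
  ring

/-- The behaviour of the theta function near the cusp `2 r`. -/
theorem norm_jacobiTheta_sub_cusp_le (r : ℚ) {z : ℂ} (hz : 0 < z.im) :
    ‖jacobiTheta (2 * r + z) -
        gaussTheta r / (√(r.den : ℝ) : ℂ) / (-Complex.I * z) ^ (1 / 2 : ℂ)‖ ≤
      2 * (r.den : ℝ) * √(r.den : ℝ) * (‖z‖ ^ 2 / √‖z‖ / z.im) := by
  have : NeZero r.den := ⟨r.den_ne_zero⟩
  set q : ℕ := r.den with hq
  have hqpos : (0 : ℝ) < q := Nat.cast_pos.2 r.den_pos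
  have hz0 : z ≠ 0 := by rintro rfl; simp at hz
  have hzn : 0 < ‖z‖ := norm_pos_iff.2 hz0
  have hsqrt : (√(q : ℝ) : ℂ) * (√(q : ℝ) : ℂ) = q := by
    rw [← Complex.ofReal_mul, Real.mul_self_sqrt hqpos.le, Complex.ofReal_natCast]
  have h := hasSum_jacobiTheta_cusp q r.num hz
  have hr : (r : ℂ) = (r.num : ℂ) / (q : ℂ) := Rat.cast_def r
  have hroot : (-Complex.I * ((q : ℂ) ^ 2 * z)) ^ (1 / 2 : ℂ) =
      q * (-Complex.I * z) ^ (1 / 2 : ℂ) := by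
    have : -Complex.I * ((q : ℂ) ^ 2 * z) = ((q : ℝ) : ℂ) ^ 2 * (-Complex.I * z) := by
      push_cast; ring
    rw [this, sq_mul_cpow_half hqpos (by simp [hz0]), Complex.ofReal_natCast]
  set w : ℂ := (-Complex.I * z) ^ (1 / 2 : ℂ) with hw
  have hwn : ‖w‖ = √‖z‖ := by rw [hw, norm_cpow_half]; simp
  set F : ℤ → ℂ := fun k ↦ 1 / (q * w) *
    (quadSum q r.num k * Complex.exp (Real.pi * Complex.I * k ^ 2 * (-1 / (q ^ 2 * z)))) with hF
  have h' : HasSum F (jacobiTheta (2 * r + z)) := by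
    rw [hr, hF, ← hroot]
    exact h
  -- The dual frequency `k = 0` is the main term; all others go into the error.
  have h0 : F 0 = gaussTheta r / (√(q : ℝ) : ℂ) / w := by
    rw [gaussTheta_eq_quadSum, ← hq, div_div (quadSum q r.num 0), hsqrt]
    simp only [hF, Int.cast_zero, ne_eq, OfNat.ofNat_ne_zero, not_false_eq_true, zero_pow, mul_zero,
      zero_mul, Complex.exp_zero, mul_one]
    field_simp
  have h1 : HasSum (fun k ↦ if k = 0 then 0 else F k)
      (jacobiTheta (2 * r + z) - gaussTheta r / (√(q : ℝ) : ℂ) / w) := by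
    rw [← h0]
    have := h'.update 0 0
    rw [zero_sub, neg_add_eq_sub] at this
    refine this.of_forall_eq fun k ↦ ?_
    rw [Function.update_apply]
  -- The imaginary part of the dual variable `-1/(q² z)`: the `k`-th term decays like `exp(-π k²
  -- y)`, and bounding this by `1/(π k² y)` is enough for summability.
  set y : ℝ := z.im / (q ^ 2 * ‖z‖ ^ 2) with hy
  have hy0 : 0 < y := by positivity
  have him : (-1 / ((q : ℂ) ^ 2 * z)).im = y := by
    rw [show -1 / ((q : ℂ) ^ 2 * z) = (((-1 / (q : ℝ) ^ 2) : ℝ) : ℂ) * z⁻¹ by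
      push_cast; field_simp, Complex.im_ofReal_mul, Complex.inv_im, Complex.normSq_eq_norm_sq, hy]
    field_simp
  have hbound : ∀ k : ℤ, ‖if k = 0 then 0 else F k‖ ≤
      (1 / (q * √‖z‖) * √(2 * q) / (Real.pi * y)) * (1 / (k : ℝ) ^ 2) := by
    intro k
    split_ifs with hk
    · simp [hk]
    · have hk' : (0 : ℝ) < (k : ℝ) ^ 2 := by positivity
      have he : ‖Complex.exp (Real.pi * Complex.I * k ^ 2 * (-1 / (q ^ 2 * z)))‖ ≤
          1 / (Real.pi * y * (k : ℝ) ^ 2) := by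
        rw [Complex.norm_exp]
        have : (Real.pi * Complex.I * k ^ 2 * (-1 / (q ^ 2 * z)) : ℂ) =
            ((Real.pi * (k : ℝ) ^ 2 : ℝ) : ℂ) * (Complex.I * (-1 / (q ^ 2 * z))) := by
          push_cast; ring
        rw [this, Complex.re_ofReal_mul, Complex.I_mul_re, him]
        refine le_trans (le_of_eq ?_) (exp_neg_le_inv (by positivity))
        congr 1
        ring
      rw [hF]
      simp only [norm_mul, norm_div, norm_one, Complex.norm_natCast, hwn]
      calc _ ≤ 1 / (q * √‖z‖) * (√(2 * q) * (1 / (Real.pi * y * (k : ℝ) ^ 2))) := by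
            gcongr
            exact norm_quadSum_le q (isCoprime_num_den r) k
        _ = _ := by field_simp
  have h2 := tsum_of_norm_bounded (hasSum_int_inv_sq.mul_left _) hbound
  rw [h1.tsum_eq] at h2
  refine h2.trans ?_
  rw [hy, Real.sqrt_mul (by norm_num)]
  -- The constant is `√2 π / 3 ≤ 2`: `√2` from the Gauss sum, `1/π` from the exponential and `π²/3`
  -- from the sum over `k ≠ 0`.
  have hs2 : √2 ≤ 3 / 2 := by rw [Real.sqrt_le_iff]; norm_num
  have hpi : Real.pi ≤ 4 := Real.pi_le_four
  have hsz : 0 < √‖z‖ := Real.sqrt_pos.2 hzn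
  calc _ = (√2 * Real.pi / 3) * (q * √(q : ℝ) * (‖z‖ ^ 2 / √‖z‖ / z.im)) := by
        field_simp
    _ ≤ 2 * (q * √(q : ℝ) * (‖z‖ ^ 2 / √‖z‖ / z.im)) := by
        gcongr
        nlinarith [Real.sqrt_nonneg 2, Real.pi_pos]
    _ = _ := by ring

/-! ### Integrating theta over one block of scales -/

/-- The integrand `s^{-1/2} θ(2x + is)`. -/
noncomputable def thetaPath (x s : ℝ) : ℂ :=
  (((√s)⁻¹ : ℝ) : ℂ) * jacobiTheta (2 * x + s * Complex.I)

/-- The main term `s^{-1/2} (s - 2ih)^{-1/2}` of `thetaPath` near a cusp. -/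
noncomputable def cuspKernel (h s : ℝ) : ℂ :=
  (((√s)⁻¹ : ℝ) : ℂ) / ((s : ℂ) - 2 * h * Complex.I) ^ (1 / 2 : ℂ)

theorem continuousOn_inv_sqrt : ContinuousOn (fun s : ℝ ↦ (√s)⁻¹) (Set.Ioi 0) :=
  Real.continuous_sqrt.continuousOn.inv₀ fun _ hs ↦ (Real.sqrt_pos.2 hs).ne'

theorem continuousOn_thetaPath (x : ℝ) : ContinuousOn (thetaPath x) (Set.Ioi 0) := by
  intro s hs
  refine ContinuousAt.continuousWithinAt (ContinuousAt.mul ?_ ?_)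
  · exact Complex.continuous_ofReal.continuousAt.comp
      (continuousOn_inv_sqrt.continuousAt (Ioi_mem_nhds hs))
  · refine ContinuousAt.comp (f := fun s : ℝ ↦ (2 * x + s * Complex.I : ℂ))
      (continuousAt_jacobiTheta ?_) (by fun_prop)
    simpa using hs

theorem continuousOn_cuspKernel (h : ℝ) : ContinuousOn (cuspKernel h) (Set.Ioi 0) := by
  intro s hs
  have hre : ((s : ℂ) - 2 * h * Complex.I).re = s := by simp
  refine ContinuousAt.continuousWithinAt (ContinuousAt.div ?_ ?_ ?_)
  · exact Complex.continuous_ofReal.continuousAt.comp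
      (continuousOn_inv_sqrt.continuousAt (Ioi_mem_nhds hs))
  · refine ContinuousAt.cpow (by fun_prop) continuousAt_const (Or.inl ?_)
    rw [hre]; exact hs
  · rw [Complex.cpow_ne_zero_iff]
    left
    intro h0
    rw [h0] at hre
    exact (ne_of_gt hs) hre.symm

theorem uIcc_subset_Ioi {a b : ℝ} (ha : 0 < a) (hb : 0 < b) : Set.uIcc a b ⊆ Set.Ioi 0 :=
  fun _ hs ↦ lt_of_lt_of_le (lt_min ha hb) hs.1

theorem intervalIntegrable_of_continuousOn_Ioi {E : Type*} [NormedAddCommGroup E] {f : ℝ → E}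
    (hf : ContinuousOn f (Set.Ioi 0)) {a b : ℝ} (ha : 0 < a) (hb : 0 < b) :
    IntervalIntegrable f MeasureTheory.volume a b :=
  (hf.mono (uIcc_subset_Ioi ha hb)).intervalIntegrable

theorem integral_inv_sqrt {a b : ℝ} (ha : 0 < a) (hb : 0 < b) :
    ∫ s in a..b, (√s)⁻¹ = 2 * √b - 2 * √a := by
  refine intervalIntegral.integral_eq_sub_of_hasDerivAt (f := fun s ↦ 2 * √s) (fun s hs ↦ ?_)
    (intervalIntegrable_of_continuousOn_Ioi continuousOn_inv_sqrt ha hb)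
  have hs0 : 0 < s := uIcc_subset_Ioi ha hb hs
  refine ((Real.hasDerivAt_sqrt hs0.ne').const_mul 2).congr_deriv ?_
  field_simp

theorem continuousOn_inv_sqrt_div : ContinuousOn (fun s : ℝ ↦ (√s)⁻¹ / s) (Set.Ioi 0) :=
  continuousOn_inv_sqrt.div continuousOn_id fun _ hs ↦ ne_of_gt hs

theorem integral_inv_sqrt_div {a b : ℝ} (ha : 0 < a) (hb : 0 < b) :
    ∫ s in a..b, (√s)⁻¹ / s = 2 * (√a)⁻¹ - 2 * (√b)⁻¹ := by
  rw [show 2 * (√a)⁻¹ - 2 * (√b)⁻¹ = -2 * (√b)⁻¹ - -2 * (√a)⁻¹ by ring]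
  refine intervalIntegral.integral_eq_sub_of_hasDerivAt (f := fun s ↦ -2 * (√s)⁻¹)
    (fun s hs ↦ ?_) (intervalIntegrable_of_continuousOn_Ioi continuousOn_inv_sqrt_div ha hb)
  have hs0 : 0 < s := uIcc_subset_Ioi ha hb hs
  have hq := Real.sqrt_pos.2 hs0
  refine (((Real.hasDerivAt_sqrt hs0.ne').inv hq.ne').const_mul (-2)).congr_deriv ?_
  rw [Real.sq_sqrt hs0.le]
  field_simp

theorem continuousOn_inv_sq : ContinuousOn (fun s : ℝ ↦ 1 / s ^ 2) (Set.Ioi 0) :=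
  continuousOn_const.div (continuousOn_id.pow 2) fun _ hs ↦ pow_ne_zero 2 (ne_of_gt hs)

theorem integral_inv_sq {a b : ℝ} (ha : 0 < a) (hb : 0 < b) :
    ∫ s in a..b, 1 / s ^ 2 = a⁻¹ - b⁻¹ := by
  rw [show a⁻¹ - b⁻¹ = -b⁻¹ - -a⁻¹ by ring]
  refine intervalIntegral.integral_eq_sub_of_hasDerivAt (f := fun s ↦ -s⁻¹)
    (fun s hs ↦ ?_) (intervalIntegrable_of_continuousOn_Ioi continuousOn_inv_sq ha hb)
  have hs0 : 0 < s := uIcc_subset_Ioi ha hb hs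
  refine (hasDerivAt_inv hs0.ne').neg.congr_deriv ?_
  ring

theorem norm_sub_two_mul_I_sq (h s : ℝ) : ‖(s : ℂ) - 2 * h * Complex.I‖ ^ 2 = s ^ 2 + 4 * h ^ 2 := by
  rw [← Complex.normSq_eq_norm_sq, Complex.normSq_apply]
  simp
  ring

theorem le_norm_sub_two_mul_I (h s : ℝ) : s ≤ ‖(s : ℂ) - 2 * h * Complex.I‖ := by
  refine le_of_sq_le_sq ?_ (norm_nonneg _)
  rw [norm_sub_two_mul_I_sq]
  nlinarith [sq_nonneg h]

theorem two_mul_abs_le_norm_sub_two_mul_I (h s : ℝ) :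
    2 * |h| ≤ ‖(s : ℂ) - 2 * h * Complex.I‖ := by
  refine le_of_sq_le_sq ?_ (norm_nonneg _)
  rw [norm_sub_two_mul_I_sq, mul_pow, sq_abs]
  nlinarith [sq_nonneg s]

theorem norm_cuspKernel (h : ℝ) {s : ℝ} (hs : 0 < s) :
    ‖cuspKernel h s‖ = (√s)⁻¹ / √‖(s : ℂ) - 2 * h * Complex.I‖ := by
  rw [cuspKernel, norm_div, norm_cpow_half, Complex.norm_real, Real.norm_of_nonneg (by positivity)]

theorem norm_cuspKernel_le_inv (h : ℝ) {s : ℝ} (hs : 0 < s) : ‖cuspKernel h s‖ ≤ s⁻¹ := by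
  have hq := Real.sqrt_pos.2 hs
  rw [norm_cuspKernel h hs]
  calc _ ≤ (√s)⁻¹ / √s := by
        gcongr
        exact le_norm_sub_two_mul_I h s
    _ = s⁻¹ := by
        rw [div_eq_mul_inv, ← mul_inv, Real.mul_self_sqrt hs.le]

/-- Meant for `s ≤ m`: unlike `s⁻¹`, this bound is integrable at `0`, with integral `2` over `(0,
m]`. -/
theorem norm_cuspKernel_le_inv_sqrt {h m s : ℝ} (hm : 0 < m) (hh : m ≤ 2 * |h|) (hs : 0 < s) :
    ‖cuspKernel h s‖ ≤ (√m)⁻¹ * (√s)⁻¹ := by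
  rw [norm_cuspKernel h hs, div_eq_inv_mul]
  have := Real.sqrt_pos.2 hm
  gcongr
  exact hh.trans (two_mul_abs_le_norm_sub_two_mul_I h s)

/-- With `w` the principal root of `s - 2ih`, rationalizing gives the difference as `2ih / (s w (w +
√s))`. Both `|w|` and `|w + √s|` are at least `√s`, the latter because `Re w ≥ 0`. -/
theorem norm_cuspKernel_sub_inv_le (h : ℝ) {s : ℝ} (hs : 0 < s) :
    ‖cuspKernel h s - ((s⁻¹ : ℝ) : ℂ)‖ ≤ 2 * |h| * (1 / s ^ 2) := by
  have hq := Real.sqrt_pos.2 hs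
  set w : ℂ := ((s : ℂ) - 2 * h * Complex.I) ^ (1 / 2 : ℂ) with hw
  have hz0 : ((s : ℂ) - 2 * h * Complex.I) ≠ 0 := by
    intro h0
    have := le_norm_sub_two_mul_I h s
    rw [h0, norm_zero] at this
    linarith
  have hw2 : w ^ 2 = (s : ℂ) - 2 * h * Complex.I := by
    rw [hw, ← Complex.cpow_nat_mul]
    norm_num
  have hwn : √s ≤ ‖w‖ := by
    rw [hw, norm_cpow_half]
    exact Real.sqrt_le_sqrt (le_norm_sub_two_mul_I h s)
  have hw0 : w ≠ 0 := norm_pos_iff.1 (hq.trans_le hwn)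
  have hwre : 0 ≤ w.re := by
    rw [hw, Complex.cpow_def_of_ne_zero hz0, Complex.exp_re]
    refine mul_nonneg (Real.exp_pos _).le (Real.cos_nonneg_of_mem_Icc ?_)
    have him : (Complex.log ((s : ℂ) - 2 * h * Complex.I) * (1 / 2)).im =
        Complex.arg ((s : ℂ) - 2 * h * Complex.I) / 2 := by
      rw [show (1 / 2 : ℂ) = ((1 / 2 : ℝ) : ℂ) by push_cast; ring, mul_comm,
        Complex.im_ofReal_mul, Complex.log_im]
      ring
    rw [him]
    have h1 := Complex.neg_pi_lt_arg ((s : ℂ) - 2 * h * Complex.I)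
    have h2 := Complex.arg_le_pi ((s : ℂ) - 2 * h * Complex.I)
    constructor <;> linarith
  have hsum : √s ≤ ‖w + (√s : ℝ)‖ := by
    refine le_trans ?_ (Complex.re_le_norm _)
    rw [Complex.add_re, Complex.ofReal_re]
    linarith
  have hsum0 : w + (√s : ℝ) ≠ 0 := norm_pos_iff.1 (hq.trans_le hsum)
  have hqc : ((√s : ℝ) : ℂ) ≠ 0 := Complex.ofReal_ne_zero.2 hq.ne'
  have hs2 : ((√s : ℝ) : ℂ) ^ 2 = s := by
    rw [← Complex.ofReal_pow, Real.sq_sqrt hs.le]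
  have key : cuspKernel h s - ((s⁻¹ : ℝ) : ℂ) =
      2 * h * Complex.I / ((√s : ℝ) ^ 2 * w * (w + (√s : ℝ))) := by
    rw [cuspKernel, ← hw, eq_div_iff (by simp [hqc, hw0, hsum0]), Complex.ofReal_inv,
      Complex.ofReal_inv, ← hs2]
    field_simp
    linear_combination hs2 - hw2
  rw [key, norm_div, norm_mul, norm_mul, norm_mul, norm_mul, norm_pow, Complex.norm_I,
    Complex.norm_real, Complex.norm_real, Complex.norm_two, Real.norm_of_nonneg hq.le,
    Real.norm_eq_abs, mul_one, Real.sq_sqrt hs.le]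
  calc _ ≤ 2 * |h| / (s * √s * √s) := by gcongr
    _ = _ := by
      rw [mul_assoc, Real.mul_self_sqrt hs.le]
      ring

theorem integral_norm_cuspKernel_low_le {h q q' : ℝ} (hq : 0 < q) (hqq : q ≤ q')
    (hh : 1 / (2 * (q * q')) ≤ |h|) :
    ∫ s in 1 / q' ^ 2..1 / (q * q'), ‖cuspKernel h s‖ ≤ 2 := by
  have hq' : 0 < q' := hq.trans_le hqq
  have hm : 0 < 1 / (q * q') := by positivity
  have ha : 0 < 1 / q' ^ 2 := by positivity
  have hle : 1 / q' ^ 2 ≤ 1 / (q * q') := by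
    rw [sq]; gcongr
  have hh' : 1 / (q * q') ≤ 2 * |h| := by
    have : 1 / (2 * (q * q')) = 1 / (q * q') / 2 := by field_simp
    linarith
  have hsm := Real.sqrt_pos.2 hm
  calc _ ≤ ∫ s in 1 / q' ^ 2..1 / (q * q'), (√(1 / (q * q')))⁻¹ * (√s)⁻¹ := by
        refine intervalIntegral.integral_mono_on hle
          (intervalIntegrable_of_continuousOn_Ioi (continuousOn_cuspKernel h).norm ha hm)
          (intervalIntegrable_of_continuousOn_Ioi
            (continuousOn_const.mul continuousOn_inv_sqrt) ha hm) fun s hs ↦ ?_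
        exact norm_cuspKernel_le_inv_sqrt hm hh' (ha.trans_le hs.1)
    _ = 2 - (√(1 / (q * q')))⁻¹ * (2 * √(1 / q' ^ 2)) := by
        rw [intervalIntegral.integral_const_mul, integral_inv_sqrt ha hm, mul_sub]
        congr 1
        field_simp
    _ ≤ 2 := by
        have : 0 ≤ (√(1 / (q * q')))⁻¹ * (2 * √(1 / q' ^ 2)) := by positivity
        linarith

theorem one_div_sq_le_one_div_mul {q q' : ℝ} (hq : 0 < q) (hqq : q ≤ q') :
    1 / q' ^ 2 ≤ 1 / (q * q') ∧ 1 / (q * q') ≤ 1 / q ^ 2 := by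
  have hq' : 0 < q' := hq.trans_le hqq
  constructor <;> rw [sq] <;> gcongr

theorem integral_inv_eq_log_div {q q' : ℝ} (hq : 0 < q) (hq' : 0 < q') :
    ∫ s in 1 / (q * q')..1 / q ^ 2, s⁻¹ = Real.log (q' / q) := by
  rw [integral_inv_of_pos (by positivity) (by positivity)]
  congr 1
  field_simp

/-- An upper bound suffices for a cutoff `δ` inside the block, and integrating the norm makes it
monotone in `δ`. -/
theorem norm_integral_cuspKernel_le {h q q' : ℝ} (hq : 0 < q) (hqq : q ≤ q')
    (hh : 1 / (2 * (q * q')) ≤ |h|) {δ : ℝ} (hδ : 1 / q' ^ 2 ≤ δ) (hδ' : δ ≤ 1 / q ^ 2) :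
    ‖∫ s in δ..1 / q ^ 2, cuspKernel h s‖ ≤ Real.log (q' / q) + 2 := by
  have hq' : 0 < q' := hq.trans_le hqq
  have hm : 0 < 1 / (q * q') := by positivity
  have ha : 0 < 1 / q' ^ 2 := by positivity
  have hb : 0 < 1 / q ^ 2 := by positivity
  have hδ0 : 0 < δ := ha.trans_le hδ
  obtain ⟨-, hle⟩ := one_div_sq_le_one_div_mul hq hqq
  have hint {a b : ℝ} (ha : 0 < a) (hb : 0 < b) :
      IntervalIntegrable (fun s ↦ ‖cuspKernel h s‖) MeasureTheory.volume a b :=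
    intervalIntegrable_of_continuousOn_Ioi (continuousOn_cuspKernel h).norm ha hb
  calc _ ≤ ∫ s in δ..1 / q ^ 2, ‖cuspKernel h s‖ :=
        intervalIntegral.norm_integral_le_integral_norm hδ'
    _ ≤ ∫ s in 1 / q' ^ 2..1 / q ^ 2, ‖cuspKernel h s‖ := by
        rw [← intervalIntegral.integral_add_adjacent_intervals (hint ha hδ0) (hint hδ0 hb)]
        have := intervalIntegral.integral_nonneg (μ := MeasureTheory.volume) hδ
          fun s _ ↦ norm_nonneg (cuspKernel h s)
        linarith
    _ = (∫ s in 1 / (q * q')..1 / q ^ 2, ‖cuspKernel h s‖) +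
          ∫ s in 1 / q' ^ 2..1 / (q * q'), ‖cuspKernel h s‖ := by
        rw [← intervalIntegral.integral_add_adjacent_intervals (hint ha hm) (hint hm hb), add_comm]
    _ ≤ _ := by
        refine add_le_add ?_ (integral_norm_cuspKernel_low_le hq hqq hh)
        rw [← integral_inv_eq_log_div hq hq']
        refine intervalIntegral.integral_mono_on hle (hint hm hb)
          (intervalIntegrable_of_continuousOn_Ioi
            (continuousOn_inv₀.mono fun s hs ↦ ne_of_gt hs) hm hb) fun s hs ↦ ?_
        exact norm_cuspKernel_le_inv h (hm.trans_le hs.1)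

/-- The range is split at `1/(q q')`. The lower part contributes at most `2`; on the upper part,
replacing the kernel by `1/s` costs at most `2|h| ∫ s⁻² ≤ 2`, and `∫ 1/s` is the logarithm. -/
theorem norm_integral_cuspKernel_sub_log_le {h q q' : ℝ} (hq : 0 < q) (hqq : q ≤ q')
    (hh : 1 / (2 * (q * q')) ≤ |h|) (hh' : |h| ≤ 1 / (q * q')) :
    ‖(∫ s in 1 / q' ^ 2..1 / q ^ 2, cuspKernel h s) - (Real.log (q' / q) : ℝ)‖ ≤ 4 := by
  have hq' : 0 < q' := hq.trans_le hqq
  have hm : 0 < 1 / (q * q') := by positivity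
  have ha : 0 < 1 / q' ^ 2 := by positivity
  have hb : 0 < 1 / q ^ 2 := by positivity
  obtain ⟨hle', hle⟩ := one_div_sq_le_one_div_mul hq hqq
  have hint {a b : ℝ} (ha : 0 < a) (hb : 0 < b) :
      IntervalIntegrable (cuspKernel h) MeasureTheory.volume a b :=
    intervalIntegrable_of_continuousOn_Ioi (continuousOn_cuspKernel h) ha hb
  have hinv : IntervalIntegrable (fun s : ℝ ↦ ((s⁻¹ : ℝ) : ℂ)) MeasureTheory.volume
      (1 / (q * q')) (1 / q ^ 2) :=
    intervalIntegrable_of_continuousOn_Ioi (Complex.continuous_ofReal.comp_continuousOn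
      (continuousOn_inv₀.mono fun s hs ↦ ne_of_gt hs)) hm hb
  have hsplit : (∫ s in 1 / q' ^ 2..1 / q ^ 2, cuspKernel h s) - (Real.log (q' / q) : ℝ) =
      (∫ s in 1 / q' ^ 2..1 / (q * q'), cuspKernel h s) +
        ∫ s in 1 / (q * q')..1 / q ^ 2, (cuspKernel h s - ((s⁻¹ : ℝ) : ℂ)) := by
    rw [← intervalIntegral.integral_add_adjacent_intervals (hint ha hm) (hint hm hb),
      intervalIntegral.integral_sub (hint hm hb) hinv, intervalIntegral.integral_ofReal,
      integral_inv_eq_log_div hq hq']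
    ring
  rw [hsplit]
  refine (norm_add_le _ _).trans ?_
  have h1 : ‖∫ s in 1 / q' ^ 2..1 / (q * q'), cuspKernel h s‖ ≤ 2 :=
    (intervalIntegral.norm_integral_le_integral_norm hle').trans
      (integral_norm_cuspKernel_low_le hq hqq hh)
  have h2 : ‖∫ s in 1 / (q * q')..1 / q ^ 2, (cuspKernel h s - ((s⁻¹ : ℝ) : ℂ))‖ ≤ 2 := by
    calc _ ≤ ∫ s in 1 / (q * q')..1 / q ^ 2, 2 * |h| * (1 / s ^ 2) := by
          refine intervalIntegral.norm_integral_le_of_norm_le hle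
            (Eventually.of_forall fun s hs ↦ norm_cuspKernel_sub_inv_le h (hm.trans hs.1))
            (intervalIntegrable_of_continuousOn_Ioi
              (continuousOn_const.mul continuousOn_inv_sq) hm hb)
      _ = 2 * |h| * ((1 / (q * q'))⁻¹ - (1 / q ^ 2)⁻¹) := by
          rw [intervalIntegral.integral_const_mul, integral_inv_sq hm hb]
      _ ≤ 2 * (1 / (q * q')) * (1 / (q * q'))⁻¹ := by
          have h0 : 0 ≤ (1 / q ^ 2)⁻¹ := by positivity
          have h0' : (1 / q ^ 2)⁻¹ ≤ (1 / (q * q'))⁻¹ := inv_anti₀ hm hle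
          refine mul_le_mul (by gcongr) (by linarith) (by linarith) (by positivity)
      _ = 2 := by field_simp
  linarith

theorem norm_thetaPath_sub_cuspKernel_le (x : ℝ) (r : ℚ) {s : ℝ} (hs : 0 < s) (hxr : x ≠ r) :
    ‖thetaPath x s - gaussTheta r / (√(r.den : ℝ) : ℂ) * cuspKernel (x - r) s‖ ≤
      2 * (r.den : ℝ) * √(r.den : ℝ) *
        (1 + 2 * |x - r| * √(2 * |x - r|) * ((√s)⁻¹ / s)) := by
  set h : ℝ := x - r with hh
  have hq := Real.sqrt_pos.2 hs
  have hh0 : 0 < 2 * |h| := by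
    have : 0 < |h| := abs_pos.2 (sub_ne_zero.2 hxr)
    linarith
  set z : ℂ := 2 * h + s * Complex.I with hz
  have him : z.im = s := by simp [hz]
  have hrot : -Complex.I * z = (s : ℂ) - 2 * h * Complex.I := by
    rw [hz]
    linear_combination -(s : ℂ) * Complex.I_mul_I
  have hnorm : ‖z‖ = ‖(s : ℂ) - 2 * h * Complex.I‖ := by
    rw [← hrot]; simp
  have hxz : (2 * x + s * Complex.I : ℂ) = 2 * r + z := by
    rw [hz, hh]; push_cast; ring
  have h1 := norm_jacobiTheta_sub_cusp_le r (z := z) (by rwa [him])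
  rw [him, hrot] at h1
  have h2 : thetaPath x s - gaussTheta r / (√(r.den : ℝ) : ℂ) * cuspKernel h s =
      (((√s)⁻¹ : ℝ) : ℂ) * (jacobiTheta (2 * r + z) - gaussTheta r / (√(r.den : ℝ) : ℂ) /
        ((s : ℂ) - 2 * h * Complex.I) ^ (1 / 2 : ℂ)) := by
    rw [thetaPath, cuspKernel, hxz]
    ring
  rw [h2, norm_mul, Complex.norm_real, Real.norm_of_nonneg (by positivity)]
  -- Here `‖z‖² = s² + (2h)²`, and in each summand the denominator is bounded below by the matching
  -- coordinate.
  have h3 : ‖z‖ ^ 2 / √‖z‖ ≤ s ^ 2 / √s + (2 * |h|) ^ 2 / √(2 * |h|) := by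
    rw [hnorm, norm_sub_two_mul_I_sq, add_div, mul_pow, sq_abs]
    have : (0 : ℝ) < √(2 * |h|) := Real.sqrt_pos.2 hh0
    gcongr
    · exact le_norm_sub_two_mul_I h s
    · norm_num
    · exact two_mul_abs_le_norm_sub_two_mul_I h s
  have h4 : (2 * |h|) ^ 2 / √(2 * |h|) = 2 * |h| * √(2 * |h|) := by
    rw [div_eq_iff (Real.sqrt_pos.2 hh0).ne', mul_assoc, Real.mul_self_sqrt hh0.le, sq]
  have h5 : (√s)⁻¹ * (s ^ 2 / √s / s) = 1 := by
    have : (√s)⁻¹ * (s ^ 2 / √s / s) = s / (√s * √s) := by field_simp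
    rw [this, Real.mul_self_sqrt hs.le, div_self hs.ne']
  calc _ ≤ (√s)⁻¹ * (2 * (r.den : ℝ) * √(r.den : ℝ) *
          ((s ^ 2 / √s + 2 * |h| * √(2 * |h|)) / s)) := by
        refine mul_le_mul_of_nonneg_left (h1.trans ?_) (by positivity)
        rw [← h4]
        gcongr
    _ = 2 * (r.den : ℝ) * √(r.den : ℝ) *
          ((√s)⁻¹ * (s ^ 2 / √s / s) + 2 * |h| * √(2 * |h|) * ((√s)⁻¹ / s)) := by ring
    _ = _ := by rw [h5]

/-- The error integrates to order `q^{3/2} (q⁻² + |h|^{3/2} δ^{-1/2})`. Since `|h| ≤ 1/(q q')` and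
`δ^{-1/2} ≤ q'`, this is `O(q^{-1/2} + q'^{-1/2})`; the constant is `2 + 8 · 3/2`. -/
theorem norm_integral_thetaPath_sub_cuspKernel_le {x : ℝ} {r : ℚ} (hxr : x ≠ r) {q' : ℝ}
    (hqq : (r.den : ℝ) ≤ q') (hh : |x - r| ≤ 1 / (r.den * q')) {δ : ℝ} (hδ : 1 / q' ^ 2 ≤ δ)
    (hδ' : δ ≤ 1 / (r.den : ℝ) ^ 2) :
    ‖(∫ s in δ..1 / (r.den : ℝ) ^ 2, thetaPath x s) -
        gaussTheta r / (√(r.den : ℝ) : ℂ) * ∫ s in δ..1 / (r.den : ℝ) ^ 2, cuspKernel (x - r) s‖ ≤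
      14 / √(r.den : ℝ) := by
  set q : ℝ := (r.den : ℝ) with hqdef
  have hq : 0 < q := Nat.cast_pos.2 r.den_pos
  have hq' : 0 < q' := hq.trans_le hqq
  have hδ0 : 0 < δ := lt_of_lt_of_le (by positivity) hδ
  have hb : 0 < 1 / q ^ 2 := by positivity
  have hsq := Real.sqrt_pos.2 hq
  have hsq' := Real.sqrt_pos.2 hq'
  have hqs : √q * √q = q := Real.mul_self_sqrt hq.le
  have hqs' : √q' * √q' = q' := Real.mul_self_sqrt hq'.le
  set κ : ℝ := 2 * |x - r| * √(2 * |x - r|) with hκ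
  have hκ0 : 0 ≤ κ := by positivity
  rw [← intervalIntegral.integral_const_mul, ← intervalIntegral.integral_sub
    (intervalIntegrable_of_continuousOn_Ioi (continuousOn_thetaPath x) hδ0 hb)
    ((intervalIntegrable_of_continuousOn_Ioi
      (continuousOn_cuspKernel _) hδ0 hb).const_mul _)]
  have hint := intervalIntegrable_of_continuousOn_Ioi
    (continuousOn_const.mul continuousOn_inv_sqrt_div) hδ0 hb (f := fun s : ℝ ↦ κ * ((√s)⁻¹ / s))
  have hδs : (√δ)⁻¹ ≤ q' := by
    rw [inv_le_comm₀ (Real.sqrt_pos.2 hδ0) hq']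
    refine Real.le_sqrt_of_sq_le ?_
    rwa [inv_pow, ← one_div]
  have hκle : κ ≤ 2 / (q * q') * (√2 / (√q * √q')) := by
    have : 2 * |x - r| ≤ 2 / (q * q') := by
      rw [show 2 / (q * q') = 2 * (1 / (q * q')) by ring]
      linarith
    have h2 : √(2 * |x - r|) ≤ √2 / (√q * √q') := by
      rw [← Real.sqrt_mul hq.le, ← Real.sqrt_div (by norm_num)]
      exact Real.sqrt_le_sqrt this
    rw [hκ]
    gcongr
  have hs2 : √2 ≤ 3 / 2 := by rw [Real.sqrt_le_iff]; norm_num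
  calc _ ≤ ∫ s in δ..1 / q ^ 2, 2 * q * √q * (1 + κ * ((√s)⁻¹ / s)) := by
        refine intervalIntegral.norm_integral_le_of_norm_le hδ'
          (Eventually.of_forall fun s hs ↦ ?_) ((intervalIntegrable_const.add hint).const_mul _)
        exact norm_thetaPath_sub_cuspKernel_le x r (hδ0.trans hs.1) hxr
    _ = 2 * q * √q * ((1 / q ^ 2 - δ) + κ * (2 * (√δ)⁻¹ - 2 * (√(1 / q ^ 2))⁻¹)) := by
        rw [intervalIntegral.integral_const_mul, intervalIntegral.integral_add
          intervalIntegrable_const hint, intervalIntegral.integral_const_mul,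
          integral_inv_sqrt_div hδ0 hb, intervalIntegral.integral_const, smul_eq_mul, mul_one]
    _ ≤ 2 * q * √q * (1 / q ^ 2 + κ * (2 * q')) := by
        have : 0 ≤ (√(1 / q ^ 2))⁻¹ := by positivity
        gcongr <;> linarith
    _ ≤ 2 * q * √q * (1 / q ^ 2 + 2 / (q * q') * (√2 / (√q * √q')) * (2 * q')) := by
        gcongr
    _ = 2 * (√q / q) + 8 * √2 / √q' := by
        field_simp
        ring
    _ ≤ 2 / √q + 8 * (3 / 2) / √q := by
        have h1 : √q / q = 1 / √q := by
          rw [div_eq_div_iff hq.ne' hsq.ne', hqs, one_mul]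
        rw [h1, mul_one_div]
        have := Real.sqrt_le_sqrt hqq
        gcongr
    _ = _ := by ring

theorem norm_integral_thetaPath_le {x : ℝ} {r : ℚ} {q' : ℝ}
    (hqq : (r.den : ℝ) ≤ q') (hh : 1 / (2 * (r.den * q')) ≤ |x - r|)
    (hh' : |x - r| ≤ 1 / (r.den * q')) {δ : ℝ} (hδ : 1 / q' ^ 2 ≤ δ)
    (hδ' : δ ≤ 1 / (r.den : ℝ) ^ 2) :
    ‖∫ s in δ..1 / (r.den : ℝ) ^ 2, thetaPath x s‖ ≤
      ‖gaussTheta r / (√(r.den : ℝ) : ℂ) * (Real.log (q' / r.den) : ℝ)‖ + 20 / √(r.den : ℝ) := by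
  have hq : (0 : ℝ) < r.den := Nat.cast_pos.2 r.den_pos
  have hq' : 0 < q' := hq.trans_le hqq
  have hsq := Real.sqrt_pos.2 hq
  have hxr : x ≠ r := sub_ne_zero.1 (abs_pos.1 (lt_of_lt_of_le (by positivity) hh))
  have h1 := norm_integral_thetaPath_sub_cuspKernel_le hxr hqq hh' hδ hδ'
  have h2 := norm_integral_cuspKernel_le hq hqq hh hδ hδ'
  have h3 := norm_le_norm_add_norm_sub' (∫ s in δ..1 / (r.den : ℝ) ^ 2, thetaPath x s)
    (gaussTheta r / (√(r.den : ℝ) : ℂ) * ∫ s in δ..1 / (r.den : ℝ) ^ 2, cuspKernel (x - r) s)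
  have hlog : 0 ≤ Real.log (q' / r.den) := Real.log_nonneg ((one_le_div hq).2 hqq)
  have hs2 : √2 ≤ 3 / 2 := by rw [Real.sqrt_le_iff]; norm_num
  have h4 : ‖gaussTheta r / (√(r.den : ℝ) : ℂ)‖ ≤ 3 / 2 / √(r.den : ℝ) := by
    rw [norm_div, Complex.norm_real, Real.norm_of_nonneg hsq.le]
    gcongr
    exact (norm_gaussTheta_le r).trans hs2
  have h5 : ‖gaussTheta r / (√(r.den : ℝ) : ℂ) *
      ∫ s in δ..1 / (r.den : ℝ) ^ 2, cuspKernel (x - r) s‖ ≤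
      ‖gaussTheta r / (√(r.den : ℝ) : ℂ) * (Real.log (q' / r.den) : ℝ)‖ +
        3 / 2 / √(r.den : ℝ) * 2 := by
    rw [norm_mul, norm_mul, Complex.norm_real, Real.norm_of_nonneg hlog]
    nlinarith [norm_nonneg (gaussTheta r / (√(r.den : ℝ) : ℂ))]
  -- The total is only `17`; `20` matches the `14 + 6` of `norm_integral_thetaPath_sub_log_le`.
  have h6 : 3 / 2 / √(r.den : ℝ) * 2 + 14 / √(r.den : ℝ) ≤ 20 / √(r.den : ℝ) := by
    rw [div_mul_eq_mul_div, ← add_div]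
    gcongr
    norm_num
  linarith

theorem norm_integral_thetaPath_sub_log_le {x : ℝ} {r : ℚ} {q' : ℝ}
    (hqq : (r.den : ℝ) ≤ q') (hh : 1 / (2 * (r.den * q')) ≤ |x - r|)
    (hh' : |x - r| ≤ 1 / (r.den * q')) :
    ‖(∫ s in 1 / q' ^ 2..1 / (r.den : ℝ) ^ 2, thetaPath x s) -
      gaussTheta r / (√(r.den : ℝ) : ℂ) * (Real.log (q' / r.den) : ℝ)‖ ≤ 20 / √(r.den : ℝ) := by
  have hq : (0 : ℝ) < r.den := Nat.cast_pos.2 r.den_pos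
  have hq' : 0 < q' := hq.trans_le hqq
  have hsq := Real.sqrt_pos.2 hq
  have hxr : x ≠ r := sub_ne_zero.1 (abs_pos.1 (lt_of_lt_of_le (by positivity) hh))
  obtain ⟨ha, hb⟩ := one_div_sq_le_one_div_mul hq hqq
  have h1 := norm_integral_thetaPath_sub_cuspKernel_le hxr hqq hh' le_rfl (ha.trans hb)
  have h2 := norm_integral_cuspKernel_sub_log_le hq hqq hh hh'
  have hs2 : √2 ≤ 3 / 2 := by rw [Real.sqrt_le_iff]; norm_num
  have h4 : ‖gaussTheta r / (√(r.den : ℝ) : ℂ)‖ ≤ 3 / 2 / √(r.den : ℝ) := by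
    rw [norm_div, Complex.norm_real, Real.norm_of_nonneg hsq.le]
    gcongr
    exact (norm_gaussTheta_le r).trans hs2
  have h5 : ‖gaussTheta r / (√(r.den : ℝ) : ℂ) *
      ((∫ s in 1 / q' ^ 2..1 / (r.den : ℝ) ^ 2, cuspKernel (x - r) s) -
        (Real.log (q' / r.den) : ℝ))‖ ≤ 3 / 2 / √(r.den : ℝ) * 4 := by
    rw [norm_mul]
    gcongr
  calc _ = ‖((∫ s in 1 / q' ^ 2..1 / (r.den : ℝ) ^ 2, thetaPath x s) -
        gaussTheta r / (√(r.den : ℝ) : ℂ) *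
          ∫ s in 1 / q' ^ 2..1 / (r.den : ℝ) ^ 2, cuspKernel (x - r) s) +
        gaussTheta r / (√(r.den : ℝ) : ℂ) *
          ((∫ s in 1 / q' ^ 2..1 / (r.den : ℝ) ^ 2, cuspKernel (x - r) s) -
            (Real.log (q' / r.den) : ℝ))‖ := by
        congr 1; ring
    _ ≤ 14 / √(r.den : ℝ) + 3 / 2 / √(r.den : ℝ) * 4 := norm_add_le_of_le h1 h5
    _ = _ := by ring

/-! ### Van der Corput's inequality and Weyl's theorem -/

theorem norm_expE (t : ℝ) : ‖expE t‖ = 1 := by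
  rw [expE, show (2 * Real.pi * Complex.I * t : ℂ) = ((2 * Real.pi * t : ℝ) : ℂ) * Complex.I by
    push_cast; ring, Complex.norm_exp_ofReal_mul_I]

theorem expE_add (s t : ℝ) : expE (s + t) = expE s * expE t := by
  rw [expE, expE, expE, ← Complex.exp_add]
  congr 1
  push_cast
  ring

theorem conj_expE (t : ℝ) : (starRingEnd ℂ) (expE t) = expE (-t) := by
  rw [expE, expE, ← Complex.exp_conj]
  congr 1
  simp only [map_mul, Complex.conj_ofReal, Complex.conj_I, Complex.conj_ofNat, Complex.ofReal_neg]
  ring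

theorem expE_natCast_mul (n : ℕ) (t : ℝ) : expE (n * t) = expE t ^ n := by
  rw [expE, expE, ← Complex.exp_nat_mul]
  congr 1
  push_cast
  ring

theorem expE_ne_one {t : ℝ} (ht : Irrational t) : expE t ≠ 1 := by
  intro h
  rw [expE, Complex.exp_eq_one_iff] at h
  obtain ⟨n, hn⟩ := h
  have h2 : (t : ℂ) = n := by
    have : (2 * Real.pi * Complex.I : ℂ) ≠ 0 := Complex.two_pi_I_ne_zero
    apply mul_left_cancel₀ this
    linear_combination hn
  exact ht.ne_int n (by exact_mod_cast h2)

theorem norm_sum_shift_sub_le {a : ℕ → ℂ} (ha : ∀ n, ‖a n‖ ≤ 1) (N h : ℕ) :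
    ‖∑ n ∈ Finset.range N, a (n + h) - ∑ n ∈ Finset.range N, a n‖ ≤ 2 * h := by
  induction h with
  | zero => simp
  | succ h ih =>
    have h1 := Finset.sum_range_succ (fun n ↦ a (n + h)) N
    have h2 := Finset.sum_range_succ' (fun n ↦ a (n + h)) N
    have h3 : ∑ n ∈ Finset.range N, a (n + (h + 1)) - ∑ n ∈ Finset.range N, a n =
        (∑ n ∈ Finset.range N, a (n + h) - ∑ n ∈ Finset.range N, a n) + (a (N + h) - a h) := by
      rw [h1] at h2
      simp only [zero_add, add_right_comm _ 1 h] at h2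
      simp only [← add_assoc]
      linear_combination -h2
    rw [h3]
    have := norm_add_le_of_le ih (norm_sub_le_of_le (ha (N + h)) (ha h))
    refine this.trans (le_of_eq ?_)
    push_cast; ring

/-- A form of van der Corput's inequality: shifts whose correlations are bounded by `c` give a
quantitative saving in the exponential sum. -/
theorem norm_sum_mul_le_of_correlation_le {a : ℕ → ℂ} (ha : ∀ n, ‖a n‖ ≤ 1) {H N : ℕ}
    {c : ℕ → ℕ → ℝ} (hc : ∀ h h', ‖∑ n ∈ Finset.range N, a (n + h) * (starRingEnd ℂ) (a (n + h'))‖ ≤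
      c h h' + if h = h' then (N : ℝ) else 0) :
    H * ‖∑ n ∈ Finset.range N, a n‖ ≤
      2 * H ^ 2 + √(N * (∑ h ∈ Finset.range H, ∑ h' ∈ Finset.range H, c h h' + H * N)) := by
  set b : ℕ → ℂ := fun n ↦ ∑ h ∈ Finset.range H, a (n + h) with hb
  have h1 : ‖∑ n ∈ Finset.range N, b n - H * ∑ n ∈ Finset.range N, a n‖ ≤ 2 * H ^ 2 := by
    rw [hb, Finset.sum_comm, show (H : ℂ) * ∑ n ∈ Finset.range N, a n =
      ∑ h ∈ Finset.range H, ∑ n ∈ Finset.range N, a n by simp, ← Finset.sum_sub_distrib]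
    calc _ ≤ ∑ h ∈ Finset.range H, (2 * H : ℝ) := by
          refine norm_sum_le_of_le _ fun h hh ↦ (norm_sum_shift_sub_le ha N h).trans ?_
          have : (h : ℝ) ≤ H := Nat.cast_le.2 (Finset.mem_range.1 hh).le
          linarith
      _ = _ := by simp; ring
  -- Cauchy–Schwarz over `n`, then expansion of `‖b n‖²` into correlations; the diagonal `h = h'`
  -- gives `H N`.
  have h2 : ‖∑ n ∈ Finset.range N, b n‖ ^ 2 ≤
      N * (∑ h ∈ Finset.range H, ∑ h' ∈ Finset.range H, c h h' + H * N) := by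
    have hsq : (∑ n ∈ Finset.range N, ‖b n‖ ^ 2 : ℝ) ≤
        ∑ h ∈ Finset.range H, ∑ h' ∈ Finset.range H, c h h' + H * N := by
      have e : ((∑ n ∈ Finset.range N, ‖b n‖ ^ 2 : ℝ) : ℂ) =
          ∑ h ∈ Finset.range H, ∑ h' ∈ Finset.range H,
            ∑ n ∈ Finset.range N, a (n + h) * (starRingEnd ℂ) (a (n + h')) := by
        push_cast
        calc _ = ∑ n ∈ Finset.range N, ∑ h ∈ Finset.range H, ∑ h' ∈ Finset.range H,
              a (n + h) * (starRingEnd ℂ) (a (n + h')) := by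
              refine Finset.sum_congr rfl fun n _ ↦ ?_
              rw [← Complex.mul_conj', hb, map_sum, Finset.sum_mul_sum]
          _ = _ := by
              rw [Finset.sum_comm]
              exact Finset.sum_congr rfl fun h _ ↦ Finset.sum_comm
      calc _ = ‖((∑ n ∈ Finset.range N, ‖b n‖ ^ 2 : ℝ) : ℂ)‖ := by
            rw [Complex.norm_real, Real.norm_of_nonneg (by positivity)]
        _ ≤ ∑ h ∈ Finset.range H, ∑ h' ∈ Finset.range H, (c h h' + if h = h' then (N : ℝ) else 0) := by
            rw [e]
            exact norm_sum_le_of_le _ fun h _ ↦ norm_sum_le_of_le _ fun h' _ ↦ hc h h'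
        _ = _ := by
            simp only [Finset.sum_add_distrib]
            congr 1
            simp +contextual [Finset.sum_ite_eq]
    calc _ ≤ (∑ n ∈ Finset.range N, ‖b n‖) ^ 2 := by
          gcongr; exact norm_sum_le _ _
      _ ≤ N * ∑ n ∈ Finset.range N, ‖b n‖ ^ 2 := by
          simpa using sq_sum_le_card_mul_sum_sq (s := Finset.range N) (f := fun n ↦ ‖b n‖)
      _ ≤ _ := by gcongr
  have h3 := Real.le_sqrt_of_sq_le h2
  calc _ = ‖(H : ℂ) * ∑ n ∈ Finset.range N, a n‖ := by simp
    _ ≤ ‖∑ n ∈ Finset.range N, b n - H * ∑ n ∈ Finset.range N, a n‖ +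
        ‖∑ n ∈ Finset.range N, b n‖ := by
        rw [add_comm]; exact norm_le_norm_add_norm_sub _ _
    _ ≤ _ := add_le_add h1 h3

/-- Since `c` does not depend on `N`, letting `N → ∞` with `H` fixed leaves a limit superior of at
most `1/√H`, and `H` is arbitrary. The extra `1/H` in `key` is slack giving a strict inequality. -/
theorem tendsto_norm_sum_div_of_correlation_le {a : ℕ → ℂ} (ha : ∀ n, ‖a n‖ ≤ 1)
    {c : ℕ → ℕ → ℝ} (hc : ∀ N h h',
      ‖∑ n ∈ Finset.range N, a (n + h) * (starRingEnd ℂ) (a (n + h'))‖ ≤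
        c h h' + if h = h' then (N : ℝ) else 0) :
    Tendsto (fun N : ℕ ↦ ‖∑ n ∈ Finset.range N, a n‖ / N) atTop (𝓝 0) := by
  have key (H : ℕ) (hH : 0 < H) : ∀ᶠ N : ℕ in atTop,
      ‖∑ n ∈ Finset.range N, a n‖ / N ≤ 1 / √H + 1 / H := by
    set K := ∑ h ∈ Finset.range H, ∑ h' ∈ Finset.range H, c h h' with hK
    have hH' : (0 : ℝ) < H := Nat.cast_pos.2 hH
    have hlim : Tendsto (fun N : ℕ ↦ 2 * H / (N : ℝ) + √(K / H ^ 2 / N + 1 / H)) atTop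
        (𝓝 (0 + √(0 + 1 / H))) :=
      (tendsto_const_div_atTop_nhds_zero_nat _).add
        (((tendsto_const_div_atTop_nhds_zero_nat _).add_const _).sqrt)
    have hlt : 0 + √(0 + 1 / (H : ℝ)) < 1 / √H + 1 / H := by
      rw [zero_add, zero_add, Real.sqrt_div zero_le_one, Real.sqrt_one]
      have : 0 < 1 / (H : ℝ) := by positivity
      linarith
    filter_upwards [hlim.eventually_lt_const hlt, eventually_gt_atTop 0] with N hN hN0
    have hN0' : (0 : ℝ) < N := Nat.cast_pos.2 hN0
    refine le_trans ?_ hN.le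
    have h := norm_sum_mul_le_of_correlation_le ha (H := H) (hc N)
    rw [← hK] at h
    have h2 : √(N * (K + H * N)) = H * N * √(K / H ^ 2 / N + 1 / H) := by
      rw [show (N : ℝ) * (K + H * N) = (H * N) ^ 2 * (K / H ^ 2 / N + 1 / H) by field_simp,
        Real.sqrt_mul (by positivity), Real.sqrt_sq (by positivity)]
    rw [h2] at h
    rw [div_le_iff₀ hN0']
    refine le_of_mul_le_mul_left (h.trans (le_of_eq ?_)) hH'
    field_simp
  have hlim2 : Tendsto (fun H : ℕ ↦ 1 / √(H : ℝ) + 1 / (H : ℝ)) atTop (𝓝 (0 + 0)) := by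
    refine Tendsto.add ?_ tendsto_one_div_atTop_nhds_zero_nat
    simp only [one_div]
    exact tendsto_inv_atTop_zero.comp (Real.tendsto_sqrt_atTop.comp tendsto_natCast_atTop_atTop)
  rw [add_zero] at hlim2
  rw [Metric.tendsto_nhds]
  intro ε hε
  obtain ⟨H, hH, hH0⟩ := ((hlim2.eventually_lt_const hε).and (eventually_gt_atTop 0)).exists
  filter_upwards [key H hH0] with N hN
  rw [Real.dist_0_eq_abs, abs_of_nonneg (by positivity)]
  exact hN.trans_lt hH

/-- Weyl's theorem for the quadratic exponential sum. -/
theorem tendsto_norm_sum_expE_sq_div {x : ℝ} (hx : Irrational x) :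
    Tendsto (fun N : ℕ ↦ ‖∑ n ∈ Finset.range N, expE ((n : ℝ) ^ 2 * x)‖ / N) atTop (𝓝 0) := by
  refine tendsto_norm_sum_div_of_correlation_le (a := fun n ↦ expE ((n : ℝ) ^ 2 * x))
    (fun n ↦ (norm_expE _).le)
    -- Off the diagonal the phase difference is linear in `n`, so the correlation is a geometric sum
    -- whose ratio is not `1` by irrationality. On the diagonal the quotient is `2 / 0 = 0`, and the
    -- separate term `N` takes over.
    (c := fun h h' ↦ 2 / ‖expE (2 * ((h : ℝ) - h') * x) - 1‖) fun N h h' ↦ ?_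
  split_ifs with hh
  · subst hh
    calc _ ≤ ∑ n ∈ Finset.range N, (1 : ℝ) := by
          refine norm_sum_le_of_le _ fun n _ ↦ ?_
          rw [norm_mul, RCLike.norm_conj, norm_expE, one_mul]
      _ ≤ _ := by
          simp only [Finset.sum_const, Finset.card_range, nsmul_eq_mul, mul_one]
          exact le_add_of_nonneg_left (by positivity)
  · have hirr : Irrational (2 * ((h : ℝ) - h') * x) := by
      have h0 : (2 * ((h : ℤ) - h') : ℤ) ≠ 0 := by omega
      have := hx.intCast_mul h0
      push_cast at this
      exact this
    have hw := expE_ne_one hirr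
    set w := expE (2 * ((h : ℝ) - h') * x) with hwdef
    have e : ∀ n : ℕ, expE (((n + h : ℕ) : ℝ) ^ 2 * x) *
        (starRingEnd ℂ) (expE (((n + h' : ℕ) : ℝ) ^ 2 * x)) =
        expE (((h : ℝ) ^ 2 - h' ^ 2) * x) * w ^ n := by
      intro n
      rw [conj_expE, ← expE_add, hwdef, ← expE_natCast_mul, ← expE_add]
      congr 1
      push_cast
      ring
    simp only [e]
    rw [← Finset.mul_sum, norm_mul, norm_expE, one_mul, geom_sum_eq hw, norm_div, add_zero]
    gcongr
    refine (norm_sub_le _ _).trans ?_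
    rw [norm_pow, hwdef, norm_expE]
    norm_num

/-! ### Replacing the sharp cutoff by a theta integral -/

section SmoothedSeries

open MeasureTheory

/-- The weight `s^{-1/2} exp (-π n² s)`, whose integral over `(0, ∞)` is `1 / n`. -/
noncomputable def gaussWeight (n : ℕ) (s : ℝ) : ℝ :=
  (√s)⁻¹ * Real.exp (-(Real.pi * n ^ 2 * s))

theorem gaussWeight_nonneg (n : ℕ) (s : ℝ) : 0 ≤ gaussWeight n s := by
  unfold gaussWeight; positivity

theorem gaussWeight_anti {m n : ℕ} (h : m ≤ n) {s : ℝ} (hs : 0 ≤ s) :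
    gaussWeight n s ≤ gaussWeight m s := by
  unfold gaussWeight
  gcongr

theorem integral_gaussWeight {n : ℕ} (hn : 0 < n) :
    ∫ s in Set.Ioi 0, gaussWeight n s = 1 / n := by
  have hn' : (0 : ℝ) < n := Nat.cast_pos.2 hn
  have h := Real.integral_rpow_mul_exp_neg_mul_Ioi (a := 1 / 2) (r := Real.pi * n ^ 2)
    (by norm_num) (by positivity)
  rw [Real.Gamma_one_half_eq, ← Real.sqrt_eq_rpow, Real.sqrt_div zero_le_one, Real.sqrt_one,
    Real.sqrt_mul Real.pi_pos.le, Real.sqrt_sq hn'.le] at h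
  rw [show (1 : ℝ) / n = 1 / (√Real.pi * n) * √Real.pi by field_simp, ← h]
  refine setIntegral_congr_fun measurableSet_Ioi fun s hs ↦ ?_
  have hs0 : (0 : ℝ) < s := hs
  simp only [gaussWeight]
  rw [Real.sqrt_eq_rpow, ← Real.rpow_neg hs0.le]
  norm_num

theorem integrableOn_gaussWeight {n : ℕ} (hn : 0 < n) :
    IntegrableOn (gaussWeight n) (Set.Ioi 0) := by
  -- A non-integrable function has integral `0` by convention, so a nonzero value proves
  -- integrability.
  refine Integrable.of_integral_ne_zero ?_
  rw [integral_gaussWeight hn]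
  positivity

/-- The index `n = 0` is included because summation by parts from `0` evaluates the weight there;
`s^{-1/2}` is integrable at `0` though not at infinity. -/
theorem integrableOn_gaussWeight_Ioc (n : ℕ) {δ : ℝ} (hδ : 0 ≤ δ) :
    IntegrableOn (gaussWeight n) (Set.Ioc 0 δ) := by
  rcases Nat.eq_zero_or_pos n with rfl | hn
  · have h := intervalIntegral.intervalIntegrable_rpow' (a := 0) (b := δ) (r := -1 / 2)
      (by norm_num)
    rw [intervalIntegrable_iff_integrableOn_Ioc_of_le hδ] at h
    refine h.congr_fun (fun s hs ↦ ?_) measurableSet_Ioc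
    simp only [gaussWeight]
    rw [Real.sqrt_eq_rpow, ← Real.rpow_neg hs.1.le]
    norm_num
  · exact (integrableOn_gaussWeight hn).mono_set Set.Ioc_subset_Ioi_self

theorem integral_gaussWeight_zero_Ioc {δ : ℝ} (hδ : 0 ≤ δ) :
    ∫ s in Set.Ioc 0 δ, gaussWeight 0 s = 2 * √δ := by
  have h := integral_rpow (a := 0) (b := δ) (r := -1 / 2) (Or.inl (by norm_num))
  rw [intervalIntegral.integral_of_le hδ, Real.zero_rpow (by norm_num), sub_zero] at h
  rw [Real.sqrt_eq_rpow]
  refine Eq.trans ?_ (h.trans ?_)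
  · refine setIntegral_congr_fun measurableSet_Ioc fun s hs ↦ ?_
    simp only [gaussWeight]
    rw [Real.sqrt_eq_rpow, ← Real.rpow_neg hs.1.le]
    norm_num
  · norm_num
    ring

/-- The part of `1 / n` carried by `(0, δ]`. -/
noncomputable def headWeight (δ : ℝ) (n : ℕ) : ℝ := ∫ s in Set.Ioc 0 δ, gaussWeight n s

/-- The part of `1 / n` carried by `(δ, ∞)`. -/
noncomputable def tailWeight (δ : ℝ) (n : ℕ) : ℝ := ∫ s in Set.Ioi δ, gaussWeight n s

theorem headWeight_add_tailWeight {δ : ℝ} (hδ : 0 ≤ δ) {n : ℕ} (hn : 0 < n) :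
    headWeight δ n + tailWeight δ n = 1 / n := by
  rw [headWeight, tailWeight, ← integral_gaussWeight hn, ← Set.Ioc_union_Ioi_eq_Ioi hδ]
  refine (setIntegral_union Set.Ioc_disjoint_Ioi_same measurableSet_Ioi
    (integrableOn_gaussWeight_Ioc n hδ)
    ((integrableOn_gaussWeight hn).mono_set (Set.Ioi_subset_Ioi hδ))).symm

theorem headWeight_nonneg (δ : ℝ) (n : ℕ) : 0 ≤ headWeight δ n :=
  integral_nonneg fun s ↦ gaussWeight_nonneg n s

theorem tailWeight_nonneg (δ : ℝ) (n : ℕ) : 0 ≤ tailWeight δ n :=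
  integral_nonneg fun s ↦ gaussWeight_nonneg n s

theorem headWeight_antitone {δ : ℝ} (hδ : 0 ≤ δ) : Antitone (headWeight δ) := fun m n h ↦
  setIntegral_mono_on (integrableOn_gaussWeight_Ioc n hδ) (integrableOn_gaussWeight_Ioc m hδ)
    measurableSet_Ioc fun _ hs ↦ gaussWeight_anti h hs.1.le

theorem headWeight_le {δ : ℝ} (hδ : 0 ≤ δ) (n : ℕ) : headWeight δ n ≤ 2 * √δ :=
  (headWeight_antitone hδ (Nat.zero_le n)).trans (integral_gaussWeight_zero_Ioc hδ).le

theorem tailWeight_anti {δ : ℝ} (hδ : 0 ≤ δ) {m n : ℕ} (hm : 0 < m) (h : m ≤ n) :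
    tailWeight δ n ≤ tailWeight δ m :=
  setIntegral_mono_on
    ((integrableOn_gaussWeight (hm.trans_le h)).mono_set (Set.Ioi_subset_Ioi hδ))
    ((integrableOn_gaussWeight hm).mono_set (Set.Ioi_subset_Ioi hδ))
    measurableSet_Ioi fun _ hs ↦ gaussWeight_anti h (hδ.trans (le_of_lt hs))

theorem tailWeight_le_one_div {δ : ℝ} (hδ : 0 ≤ δ) {n : ℕ} (hn : 0 < n) :
    tailWeight δ n ≤ 1 / n := by
  linarith [headWeight_add_tailWeight hδ hn, headWeight_nonneg δ n]

theorem tailWeight_le {δ : ℝ} (hδ : 0 < δ) {n : ℕ} (hn : 0 < n) :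
    tailWeight δ n ≤ (√δ)⁻¹ * (1 / (n : ℝ) ^ 2) := by
  have hn' : (0 : ℝ) < n := Nat.cast_pos.2 hn
  have hsq := Real.sqrt_pos.2 hδ
  have ha : -(Real.pi * n ^ 2) < 0 := by
    have : 0 < Real.pi * n ^ 2 := by positivity
    linarith
  have hint := integral_exp_mul_Ioi ha δ
  calc _ ≤ ∫ s in Set.Ioi δ, (√δ)⁻¹ * Real.exp (-(Real.pi * n ^ 2) * s) := by
        refine setIntegral_mono_on
          ((integrableOn_gaussWeight hn).mono_set (Set.Ioi_subset_Ioi hδ.le))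
          ((integrableOn_exp_mul_Ioi ha δ).const_mul _) measurableSet_Ioi fun s hs ↦ ?_
        have hs' : δ ≤ s := le_of_lt hs
        rw [gaussWeight, neg_mul]
        gcongr
    _ = (√δ)⁻¹ * (Real.exp (-(Real.pi * n ^ 2) * δ) / (Real.pi * n ^ 2)) := by
        rw [integral_const_mul, hint, neg_div_neg_eq]
    _ ≤ _ := by
        have h1 : Real.exp (-(Real.pi * n ^ 2) * δ) ≤ 1 := by
          rw [Real.exp_le_one_iff]
          exact mul_nonpos_of_nonpos_of_nonneg ha.le hδ.le
        have h2 : 1 * (n : ℝ) ^ 2 ≤ Real.pi * n ^ 2 := by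
          gcongr
          linarith [Real.pi_gt_three]
        rw [one_mul] at h2
        gcongr

/-- Summation by parts for a decreasing weight, with partial sums of at most linear growth. -/
theorem norm_sum_Ioc_mul_le {a : ℕ → ℂ} {f : ℕ → ℝ} {N : ℕ} {α β : ℝ}
    (hf0 : ∀ n, 0 ≤ f n) (hf : ∀ n, N ≤ n → f (n + 1) ≤ f n)
    (ha : ∀ n, N ≤ n → ‖∑ k ∈ Finset.Ioc N n, a k‖ ≤ α + β * n) {L : ℕ} (hL : N ≤ L) :
    ‖∑ n ∈ Finset.Ioc N L, a n * f n‖ ≤ α * f N + β * (N * f N + ∑ n ∈ Finset.Ioc N L, f n) := by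
  -- Strengthened for the induction: the boundary term is removed and its bound is put on the left,
  -- which then grows by at most `β f (L + 1)` at each step.
  have key : ‖∑ n ∈ Finset.Ioc N L, a n * f n - (∑ n ∈ Finset.Ioc N L, a n) * f L‖ +
      (α + β * L) * f L ≤ α * f N + β * (N * f N + ∑ n ∈ Finset.Ioc N L, f n) := by
    induction L, hL using Nat.le_induction with
    | base => simp; linarith
    | succ L hL ih =>
      rw [Finset.sum_Ioc_succ_top hL, Finset.sum_Ioc_succ_top hL, Finset.sum_Ioc_succ_top hL]
      have e : ∑ n ∈ Finset.Ioc N L, a n * f n + a (L + 1) * f (L + 1) -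
          (∑ n ∈ Finset.Ioc N L, a n + a (L + 1)) * f (L + 1) =
          (∑ n ∈ Finset.Ioc N L, a n * f n - (∑ n ∈ Finset.Ioc N L, a n) * f L) +
            (∑ n ∈ Finset.Ioc N L, a n) * ((f L - f (L + 1) : ℝ) : ℂ) := by
        push_cast; ring
      have h1 : ‖(∑ n ∈ Finset.Ioc N L, a n) * ((f L - f (L + 1) : ℝ) : ℂ)‖ ≤
          (α + β * L) * (f L - f (L + 1)) := by
        have h0 : 0 ≤ f L - f (L + 1) := sub_nonneg.2 (hf L hL)
        rw [norm_mul, Complex.norm_real, Real.norm_of_nonneg h0]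
        exact mul_le_mul_of_nonneg_right (ha L hL) h0
      rw [e]
      have h2 := norm_add_le (∑ n ∈ Finset.Ioc N L, a n * f n -
        (∑ n ∈ Finset.Ioc N L, a n) * f L)
          ((∑ n ∈ Finset.Ioc N L, a n) * ((f L - f (L + 1) : ℝ) : ℂ))
      push_cast at *
      linarith
  have h1 : ‖(∑ n ∈ Finset.Ioc N L, a n) * (f L : ℂ)‖ ≤ (α + β * L) * f L := by
    rw [norm_mul, Complex.norm_real, Real.norm_of_nonneg (hf0 L)]
    exact mul_le_mul_of_nonneg_right (ha L hL) (hf0 L)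
  have h2 := norm_le_norm_add_norm_sub' (∑ n ∈ Finset.Ioc N L, a n * (f n : ℂ))
    ((∑ n ∈ Finset.Ioc N L, a n) * (f L : ℂ))
  linarith

theorem exists_norm_sum_expE_sq_le {x : ℝ} (hx : Irrational x) {ε : ℝ} (hε : 0 < ε) :
    ∃ K : ℝ, 0 ≤ K ∧ ∀ N n : ℕ, N ≤ n →
      ‖∑ k ∈ Finset.Ioc N n, expE ((k : ℝ) ^ 2 * x)‖ ≤ K + ε * n := by
  have h := (tendsto_norm_sum_expE_sq_div hx).eventually_lt_const (show 0 < ε / 4 by positivity)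
  obtain ⟨M, hM⟩ := eventually_atTop.1 h
  have hA : ∀ n : ℕ, ‖∑ k ∈ Finset.range n, expE ((k : ℝ) ^ 2 * x)‖ ≤ M + ε / 4 * n := by
    intro n
    rcases le_total M n with hn | hn
    · rcases Nat.eq_zero_or_pos n with rfl | hn0
      · simp
      · have hn0' : (0 : ℝ) < n := Nat.cast_pos.2 hn0
        have h1 := (div_lt_iff₀ hn0').1 (hM n hn)
        have : (0 : ℝ) ≤ M := Nat.cast_nonneg _
        linarith
    · calc _ ≤ ∑ k ∈ Finset.range n, (1 : ℝ) := norm_sum_le_of_le _ fun k _ ↦ (norm_expE _).le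
        _ = n := by simp
        _ ≤ M + ε / 4 * n := by
          have : (n : ℝ) ≤ M := Nat.cast_le.2 hn
          have : 0 ≤ ε / 4 * n := by positivity
          linarith
  refine ⟨2 * M + ε, by positivity, fun N n hNn ↦ ?_⟩
  have h1 : ∑ k ∈ Finset.Ioc N n, expE ((k : ℝ) ^ 2 * x) =
      ∑ k ∈ Finset.range (n + 1), expE ((k : ℝ) ^ 2 * x) -
        ∑ k ∈ Finset.range (N + 1), expE ((k : ℝ) ^ 2 * x) := by
    rw [← Finset.sum_Ico_eq_sub _ (by omega)]
    congr 1
    ext k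
    simp only [Finset.mem_Ioc, Finset.mem_Ico]
    omega
  rw [h1]
  refine (norm_sub_le_of_le (hA (n + 1)) (hA (N + 1))).trans ?_
  have h2 : (N : ℝ) ≤ n := Nat.cast_le.2 hNn
  have h3 : (0 : ℝ) ≤ n := Nat.cast_nonneg _
  push_cast
  nlinarith

/-- Since `1 / n` is head plus tail, what remains is the head weights up to `N` minus the tail
weights beyond `N`. At `δ = 1/N²` both are decreasing, are `O(1/N)` at the left end of their range
and have total mass `O(1)` there, so summation by parts applies, uniformly in `L`. -/
theorem norm_fourierPartialSum_sub_le {x ε K : ℝ} (hε : 0 ≤ ε) (hK : 0 ≤ K)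
    (hA : ∀ N n : ℕ, N ≤ n → ‖∑ k ∈ Finset.Ioc N n, expE ((k : ℝ) ^ 2 * x)‖ ≤ K + ε * n)
    {N L : ℕ} (hN : 0 < N) (hL : N ≤ L) :
    ‖fourierPartialSum x N -
      ∑ n ∈ Finset.Ioc 0 L, expE ((n : ℝ) ^ 2 * x) * (tailWeight (1 / (N : ℝ) ^ 2) n : ℂ)‖ ≤
      3 * K / N + 4 * ε := by
  have hN' : (0 : ℝ) < N := Nat.cast_pos.2 hN
  set δ : ℝ := 1 / (N : ℝ) ^ 2 with hδ
  have hδ0 : 0 < δ := by positivity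
  have hsδ : √δ = 1 / N := by
    rw [hδ, Real.sqrt_div zero_le_one, Real.sqrt_one, Real.sqrt_sq hN'.le]
  have hsplit : fourierPartialSum x N -
      ∑ n ∈ Finset.Ioc 0 L, expE ((n : ℝ) ^ 2 * x) * (tailWeight δ n : ℂ) =
      ∑ n ∈ Finset.Ioc 0 N, expE ((n : ℝ) ^ 2 * x) * (headWeight δ n : ℂ) -
        ∑ n ∈ Finset.Ioc N L, expE ((n : ℝ) ^ 2 * x) * (tailWeight δ n : ℂ) := by
    rw [← Finset.sum_Ioc_consecutive _ (Nat.zero_le N) hL, ← sub_sub, fourierPartialSum]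
    congr 1
    rw [show Finset.Icc 1 N = Finset.Ioc 0 N by ext; simp [Nat.succ_le_iff],
      ← Finset.sum_sub_distrib]
    refine Finset.sum_congr rfl fun n hn ↦ ?_
    have h := headWeight_add_tailWeight hδ0.le (Finset.mem_Ioc.1 hn).1
    have h' : (headWeight δ n : ℂ) + tailWeight δ n = 1 / n := by
      have := congrArg Complex.ofReal h
      push_cast at this
      exact this
    linear_combination -expE ((n : ℝ) ^ 2 * x) * h'
  have h1 := norm_sum_Ioc_mul_le (f := headWeight δ) (N := 0) (headWeight_nonneg δ)
    (fun n _ ↦ headWeight_antitone hδ0.le n.le_succ) (fun n hn ↦ hA 0 n hn) (Nat.zero_le N)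
  have h2 := norm_sum_Ioc_mul_le (f := tailWeight δ) (tailWeight_nonneg δ)
    (fun n hn ↦ tailWeight_anti hδ0.le (hN.trans_le hn) n.le_succ) (fun n hn ↦ hA N n hn) hL
  have h3 : headWeight δ 0 ≤ 2 * (1 / N) := hsδ ▸ headWeight_le hδ0.le 0
  have h4 : ∑ n ∈ Finset.Ioc 0 N, headWeight δ n ≤ 2 := by
    calc _ ≤ ∑ n ∈ Finset.Ioc 0 N, 2 * (1 / (N : ℝ)) :=
          Finset.sum_le_sum fun n _ ↦ hsδ ▸ headWeight_le hδ0.le n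
      _ = 2 := by
          rw [Finset.sum_const, Nat.card_Ioc, nsmul_eq_mul, Nat.sub_zero]
          field_simp
  have h5 : tailWeight δ N ≤ 1 / N := tailWeight_le_one_div hδ0.le hN
  have h6 : ∑ n ∈ Finset.Ioc N L, tailWeight δ n ≤ 1 := by
    calc _ ≤ ∑ n ∈ Finset.Ioc N L, (N : ℝ) * ((n : ℝ) ^ 2)⁻¹ := by
          refine Finset.sum_le_sum fun n hn ↦ ?_
          have := tailWeight_le hδ0 (hN.trans (Finset.mem_Ioc.1 hn).1)
          rwa [hsδ, one_div, inv_inv, one_div] at this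
      _ ≤ N * ((N : ℝ)⁻¹ - (L : ℝ)⁻¹) := by
          rw [← Finset.mul_sum]
          gcongr
          exact sum_Ioc_inv_sq_le_sub hN.ne' hL
      _ ≤ 1 := by
          have : 0 ≤ (N : ℝ) * (L : ℝ)⁻¹ := by positivity
          rw [mul_sub, mul_inv_cancel₀ hN'.ne']
          linarith
  have h7 : (N : ℝ) * tailWeight δ N ≤ 1 := by
    calc _ ≤ (N : ℝ) * (1 / N) := by gcongr
      _ = 1 := by field_simp
  rw [hsplit]
  refine (norm_sub_le_of_le h1 h2).trans ?_
  calc _ ≤ K * (2 * (1 / N)) + ε * (0 + 2) + (K * (1 / N) + ε * (1 + 1)) := by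
        gcongr
        simp
    _ = _ := by ring

/-- The smoothed tail `∫_δ^∞ s^{-1/2} (θ(2x + is) - 1) / 2 ds`. -/
noncomputable def thetaTail (x δ : ℝ) : ℂ :=
  ∫ s in Set.Ioi δ, (((√s)⁻¹ : ℝ) : ℂ) * ((jacobiTheta (2 * x + s * Complex.I) - 1) / 2)

theorem summable_tailWeight {δ : ℝ} (hδ : 0 < δ) : Summable fun n : ℕ ↦ tailWeight δ (n + 1) := by
  refine Summable.of_nonneg_of_le (fun n ↦ tailWeight_nonneg _ _)
    (fun n ↦ tailWeight_le hδ n.succ_pos) (Summable.mul_left _ ?_)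
  exact (summable_nat_add_iff 1).2 (Real.summable_one_div_nat_pow.2 one_lt_two)

theorem hasSum_thetaTail (x : ℝ) {δ : ℝ} (hδ : 0 < δ) :
    HasSum (fun n : ℕ ↦ expE (((n + 1 : ℕ) : ℝ) ^ 2 * x) * (tailWeight δ (n + 1) : ℂ))
      (thetaTail x δ) := by
  set F : ℕ → ℝ → ℂ := fun n s ↦
    expE (((n + 1 : ℕ) : ℝ) ^ 2 * x) * (gaussWeight (n + 1) s : ℂ) with hF
  have hint (n : ℕ) : IntegrableOn (F n) (Set.Ioi δ) :=
    ((integrableOn_gaussWeight n.succ_pos).mono_set (Set.Ioi_subset_Ioi hδ.le)).ofReal.const_mul _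
  have hnorm (n : ℕ) : ∫ s in Set.Ioi δ, ‖F n s‖ = tailWeight δ (n + 1) := by
    refine integral_congr_ae (Eventually.of_forall fun s ↦ ?_)
    simp only [hF]
    rw [norm_mul, norm_expE, one_mul, Complex.norm_real,
      Real.norm_of_nonneg (gaussWeight_nonneg _ _)]
  have h := hasSum_integral_of_summable_integral_norm hint
    (by simp only [hnorm]; exact summable_tailWeight hδ)
  have hval : ∫ s in Set.Ioi δ, ∑' n, F n s = thetaTail x δ := by
    refine setIntegral_congr_fun measurableSet_Ioi fun s hs ↦ ?_
    have hs0 : 0 < s := hδ.trans hs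
    have h1 := (hasSum_nat_jacobiTheta (τ := 2 * x + s * Complex.I) (by simpa using hs0)).mul_left
      (((√s)⁻¹ : ℝ) : ℂ)
    rw [← h1.tsum_eq]
    refine tsum_congr fun n ↦ ?_
    simp only [hF, gaussWeight, expE]
    rw [Complex.ofReal_mul ((√s)⁻¹), mul_left_comm, Complex.ofReal_exp, ← Complex.exp_add]
    congr 2
    push_cast
    linear_combination (-(Real.pi : ℂ) * (n + 1) ^ 2 * s) * Complex.I_mul_I
  rw [hval] at h
  refine h.of_forall_eq fun n ↦ ?_
  rw [tailWeight, ← integral_complex_ofReal, ← integral_const_mul]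

theorem sum_Ioc_zero_eq_sum_range (f : ℕ → ℂ) (L : ℕ) :
    ∑ n ∈ Finset.Ioc 0 L, f n = ∑ n ∈ Finset.range L, f (n + 1) := by
  induction L with
  | zero => simp
  | succ L ih => rw [Finset.sum_Ioc_succ_top L.zero_le, Finset.sum_range_succ, ih]

theorem tendsto_fourierPartialSum_sub_thetaTail {x : ℝ} (hx : Irrational x) :
    Tendsto (fun N : ℕ ↦ fourierPartialSum x N - thetaTail x (1 / (N : ℝ) ^ 2)) atTop (𝓝 0) := by
  rw [Metric.tendsto_nhds]
  intro ε hε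
  obtain ⟨K, hK, hA⟩ := exists_norm_sum_expE_sq_le hx (show 0 < ε / 8 by positivity)
  have hlim := (tendsto_const_div_atTop_nhds_zero_nat (3 * K)).eventually_lt_const
    (show 0 < ε / 2 by positivity)
  filter_upwards [hlim, eventually_gt_atTop 0] with N hN hN0
  have hδ : (0 : ℝ) < 1 / (N : ℝ) ^ 2 := by
    have : (0 : ℝ) < N := Nat.cast_pos.2 hN0
    positivity
  have h1 := (hasSum_thetaTail x hδ).tendsto_sum_nat
  have h2 : Tendsto (fun L ↦ ‖fourierPartialSum x N -
      ∑ n ∈ Finset.range L, expE (((n + 1 : ℕ) : ℝ) ^ 2 * x) *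
        (tailWeight (1 / (N : ℝ) ^ 2) (n + 1) : ℂ)‖) atTop
      (𝓝 ‖fourierPartialSum x N - thetaTail x (1 / (N : ℝ) ^ 2)‖) := (h1.const_sub _).norm
  rw [dist_zero_right]
  refine lt_of_le_of_lt (le_of_tendsto h2 ?_) (show 3 * K / N + 4 * (ε / 8) < ε by linarith)
  filter_upwards [eventually_ge_atTop N] with L hL
  have h3 := norm_fourierPartialSum_sub_le (by positivity) hK hA hN0 hL
  rwa [sum_Ioc_zero_eq_sum_range] at h3

theorem norm_thetaTail_one_le (x : ℝ) : ‖thetaTail x 1‖ ≤ 2 := by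
  have h := hasSum_thetaTail x one_pos
  have h2 : HasSum (fun n : ℕ ↦ 1 / (((n + 1 : ℕ) : ℝ)) ^ 2) (Real.pi ^ 2 / 6) := by
    have := (hasSum_nat_add_iff' 1).2 hasSum_zeta_two
    simpa using this
  rw [← h.tsum_eq]
  refine (tsum_of_norm_bounded h2 fun n ↦ ?_).trans ?_
  · rw [norm_mul, norm_expE, one_mul, Complex.norm_real, Real.norm_of_nonneg (tailWeight_nonneg _ _)]
    simpa using tailWeight_le one_pos n.succ_pos
  · nlinarith [Real.pi_lt_d2, Real.pi_pos]

theorem integrableOn_thetaTail (x : ℝ) {δ : ℝ} (hδ : 0 < δ) :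
    IntegrableOn (fun s : ℝ ↦ (((√s)⁻¹ : ℝ) : ℂ) *
      ((jacobiTheta (2 * x + s * Complex.I) - 1) / 2)) (Set.Ioi δ) := by
  set c : ℝ := 1 / (1 - Real.exp (-Real.pi * δ)) * (√δ)⁻¹ with hc
  have hexp : Real.exp (-Real.pi * δ) < 1 := by
    rw [Real.exp_lt_one_iff]
    nlinarith [Real.pi_pos]
  have hcont : ContinuousOn (fun s : ℝ ↦ (((√s)⁻¹ : ℝ) : ℂ) *
      ((jacobiTheta (2 * x + s * Complex.I) - 1) / 2)) (Set.Ioi δ) := by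
    have h : ContinuousOn (fun s : ℝ ↦ (thetaPath x s - (((√s)⁻¹ : ℝ) : ℂ)) / 2) (Set.Ioi 0) :=
      ((continuousOn_thetaPath x).sub
        (Complex.continuous_ofReal.comp_continuousOn continuousOn_inv_sqrt)).div_const 2
    refine (h.mono (Set.Ioi_subset_Ioi hδ.le)).congr fun s _ ↦ ?_
    simp only [thetaPath]
    ring
  refine Integrable.mono' ((integrableOn_exp_mul_Ioi (a := -Real.pi) (by linarith [Real.pi_pos])
    δ).const_mul c) (hcont.aestronglyMeasurable measurableSet_Ioi) ?_
  refine (ae_restrict_iff' measurableSet_Ioi).2 (Eventually.of_forall fun s hs ↦ ?_)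
  have hs' : δ ≤ s := le_of_lt hs
  have hs0 : 0 < s := hδ.trans_le hs'
  have him : (2 * x + s * Complex.I : ℂ).im = s := by simp
  have h := norm_jacobiTheta_sub_one_le (τ := 2 * x + s * Complex.I) (by rwa [him])
  rw [him] at h
  rw [norm_mul, norm_div, Complex.norm_real, Real.norm_of_nonneg (by positivity), Complex.norm_two]
  have hsq := Real.sqrt_pos.2 hδ
  have h1 : 0 < 1 - Real.exp (-Real.pi * δ) := by linarith
  have hmono : Real.exp (-Real.pi * s) ≤ Real.exp (-Real.pi * δ) := by
    rw [Real.exp_le_exp]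
    nlinarith [Real.pi_pos]
  calc _ ≤ (√δ)⁻¹ * ((2 / (1 - Real.exp (-Real.pi * δ)) * Real.exp (-Real.pi * s)) / 2) := by
        gcongr
        refine h.trans ?_
        gcongr
    _ = _ := by rw [hc]; ring

/-- The constant `1` subtracted from theta contributes `-½ ∫_δ^1 s^{-1/2} ds = √δ - 1`. -/
theorem thetaTail_eq (x : ℝ) {δ : ℝ} (hδ : 0 < δ) :
    thetaTail x δ = (1 / 2) * (∫ s in δ..1, thetaPath x s) + ((√δ : ℝ) : ℂ) + (thetaTail x 1 - 1) := by
  have h1 : thetaTail x δ = (∫ s in δ..1, (((√s)⁻¹ : ℝ) : ℂ) *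
      ((jacobiTheta (2 * x + s * Complex.I) - 1) / 2)) + thetaTail x 1 := by
    rw [thetaTail, thetaTail, intervalIntegral.integral_interval_add_Ioi
      (integrableOn_thetaTail x hδ) (integrableOn_thetaTail x one_pos)]
  have h2 : ∫ s in δ..1, (((√s)⁻¹ : ℝ) : ℂ) * ((jacobiTheta (2 * x + s * Complex.I) - 1) / 2) =
      ∫ s in δ..1, ((1 / 2) * thetaPath x s - (1 / 2) * (((√s)⁻¹ : ℝ) : ℂ)) := by
    refine intervalIntegral.integral_congr fun s _ ↦ ?_
    simp only [thetaPath]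
    ring
  rw [h1, h2, intervalIntegral.integral_sub, intervalIntegral.integral_const_mul,
    intervalIntegral.integral_const_mul, intervalIntegral.integral_ofReal,
    integral_inv_sqrt hδ one_pos]
  · push_cast
    rw [Real.sqrt_one, Complex.ofReal_one]
    ring
  · exact (intervalIntegrable_of_continuousOn_Ioi (continuousOn_thetaPath x) hδ one_pos).const_mul _
  · exact (intervalIntegrable_of_continuousOn_Ioi
      (Complex.continuous_ofReal.comp_continuousOn continuousOn_inv_sqrt) hδ one_pos).const_mul _

/-- The smoothed partial sums `½ ∫_{1/N²}^1 s^{-1/2} θ(2x + is) ds`. -/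
noncomputable def smoothPartialSum (x : ℝ) (N : ℕ) : ℂ :=
  (1 / 2) * ∫ s in 1 / (N : ℝ) ^ 2..1, thetaPath x s

theorem exists_tendsto_fourierPartialSum_sub {x : ℝ} (hx : Irrational x) :
    ∃ d : ℂ, ‖d‖ ≤ 3 ∧
      Tendsto (fun N ↦ fourierPartialSum x N - smoothPartialSum x N) atTop (𝓝 d) := by
  refine ⟨thetaTail x 1 - 1, ?_, ?_⟩
  · refine (norm_sub_le _ _).trans ?_
    rw [norm_one]
    linarith [norm_thetaTail_one_le x]
  · have h1 : Tendsto (fun N : ℕ ↦ ((1 / (N : ℝ) : ℝ) : ℂ)) atTop (𝓝 ((0 : ℝ) : ℂ)) :=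
      (Complex.continuous_ofReal.tendsto _).comp tendsto_one_div_atTop_nhds_zero_nat
    have h2 := ((tendsto_fourierPartialSum_sub_thetaTail hx).add h1).add_const (thetaTail x 1 - 1)
    rw [Complex.ofReal_zero, add_zero, zero_add] at h2
    refine h2.congr' ?_
    filter_upwards [eventually_gt_atTop 0] with N hN
    have hN0 : (0 : ℝ) < N := Nat.cast_pos.2 hN
    have hs : √(1 / (N : ℝ) ^ 2) = 1 / N := by
      rw [Real.sqrt_div zero_le_one, Real.sqrt_one, Real.sqrt_sq hN0.le]
    rw [thetaTail_eq x (by positivity), smoothPartialSum, hs]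
    ring

end SmoothedSeries

/-! ### Summing the blocks and comparing the two series -/

/-- Comparison of a sequence `u` with a series `v` through the values of `u` along `q`. -/
theorem tendsto_of_tendsto_blocks {u v : ℕ → ℂ} {q : ℕ → ℕ} {ε : ℕ → ℝ}
    (hq : Tendsto q atTop atTop) (hε : Tendsto ε atTop (𝓝 0))
    (h : ∀ j N, q j ≤ N → N ≤ q (j + 1) → ‖u N - u (q j)‖ ≤ ‖v (j + 1) - v j‖ + ε j)
    {t c : ℂ} (hv : Tendsto v atTop (𝓝 t)) (hc : Tendsto (fun j ↦ u (q j) - v j) atTop (𝓝 c)) :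
    Tendsto u atTop (𝓝 (t + c)) := by
  have h1 : Tendsto (fun j ↦ ‖u (q j) - (t + c)‖ + (‖v (j + 1) - v j‖ + ε j)) atTop (𝓝 0) := by
    have e1 : Tendsto (fun j ↦ u (q j) - (t + c)) atTop (𝓝 0) := by
      have := (hv.add hc).sub_const (t + c)
      rw [sub_self] at this
      exact this.congr fun j ↦ by ring
    have e2 : Tendsto (fun j ↦ v (j + 1) - v j) atTop (𝓝 0) := by
      have := (hv.comp (tendsto_add_atTop_nat 1)).sub hv
      rwa [sub_self] at this
    have := e1.norm.add (e2.norm.add hε)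
    simpa using this
  rw [Metric.tendsto_atTop]
  intro η hη
  obtain ⟨J, hJ⟩ := eventually_atTop.1 (h1.eventually_lt_const hη)
  -- Monotonicity of `q` is not assumed: `M` dominates `q 0, …, q J`, so for `N ≥ M` the first `k`
  -- with `N < q k` exceeds `J`, and `N` lies in block `k - 1 ≥ J`.
  obtain ⟨M, hM⟩ : ∃ M, ∀ j ≤ J, q j ≤ M :=
    ⟨(Finset.range (J + 1)).sup q, fun j hj ↦ Finset.le_sup (Finset.mem_range.2 (by omega))⟩
  refine ⟨M, fun N hN ↦ ?_⟩
  have hex : ∃ k, N < q k := (hq.eventually_gt_atTop N).exists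
  classical
  have hk := Nat.find_spec hex
  set k := Nat.find hex with hkdef
  have hkJ : J < k := by
    by_contra! hle
    exact absurd ((hM k hle).trans hN) (not_le.2 hk)
  obtain ⟨j, hj⟩ : ∃ j, k = j + 1 := ⟨k - 1, by omega⟩
  have hqj : q j ≤ N := not_lt.1 (Nat.find_min hex (m := j) (by omega))
  rw [hj] at hk
  have h2 := h j N hqj hk.le
  have h3 := hJ j (by omega)
  rw [dist_eq_norm]
  calc _ = ‖(u (q j) - (t + c)) + (u N - u (q j))‖ := by congr 1; ring
    _ ≤ ‖u (q j) - (t + c)‖ + ‖u N - u (q j)‖ := norm_add_le _ _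
    _ < η := by linarith

theorem exists_tendsto_of_summable_increments {w : ℕ → ℂ} {ε : ℕ → ℝ} (hε : Summable ε)
    (hw0 : w 0 = 0) (hw : ∀ j, ‖w (j + 1) - w j‖ ≤ ε j) :
    ∃ c, ‖c‖ ≤ ∑' j, ε j ∧ Tendsto w atTop (𝓝 c) := by
  have hs : Summable fun j ↦ w (j + 1) - w j := hε.of_norm_bounded hw
  refine ⟨∑' j, (w (j + 1) - w j), tsum_of_norm_bounded hε.hasSum hw, ?_⟩
  have := hs.hasSum.tendsto_sum_nat
  simpa only [Finset.sum_range_sub, hw0, sub_zero] using this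

theorem tendsto_convDen {x : ℝ} (hx : Irrational x) : Tendsto (convDen x) atTop atTop := by
  refine tendsto_atTop_mono (fun n ↦ ?_) tendsto_id
  induction n using Nat.twoStepInduction with
  | zero => exact Nat.zero_le _
  | one => exact convDen_pos x 1
  | more n _ h2 =>
    have := convDen_add_le hx n
    have := convDen_pos x n
    simp only [id] at *
    omega

theorem smoothPartialSum_sub {x : ℝ} {M N : ℕ} (hM : 0 < M) (hN : 0 < N) :
    smoothPartialSum x N - smoothPartialSum x M =
      (1 / 2) * ∫ s in 1 / (N : ℝ) ^ 2..1 / (M : ℝ) ^ 2, thetaPath x s := by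
  have hM' : (0 : ℝ) < M := Nat.cast_pos.2 hM
  have hN' : (0 : ℝ) < N := Nat.cast_pos.2 hN
  have hint {a b : ℝ} (ha : 0 < a) (hb : 0 < b) :=
    intervalIntegrable_of_continuousOn_Ioi (continuousOn_thetaPath x) ha hb
  rw [smoothPartialSum, smoothPartialSum, ← mul_sub, ← intervalIntegral.integral_add_adjacent_intervals
    (hint (a := 1 / (N : ℝ) ^ 2) (b := 1 / (M : ℝ) ^ 2) (by positivity) (by positivity))
    (hint (by positivity) one_pos), add_sub_cancel_right]

theorem approxPartialSum_succ_sub (x : ℝ) (j : ℕ) :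
    approxPartialSum x (j + 1) - approxPartialSum x j =
      (1 / 2) * (gaussTheta (x.convergent j) / (√((x.convergent j).den : ℝ) : ℂ) *
        (Real.log ((convDen x (j + 1) : ℝ) / ((x.convergent j).den : ℝ)) : ℂ)) := by
  rw [approxPartialSum, approxPartialSum, ← mul_sub, Finset.sum_range_succ, add_sub_cancel_left]
  rfl

theorem norm_smoothPartialSum_sub_sub_le {x : ℝ} (hx : Irrational x) (j : ℕ) :
    ‖(smoothPartialSum x (convDen x (j + 1)) - smoothPartialSum x (convDen x j)) -
      (approxPartialSum x (j + 1) - approxPartialSum x j)‖ ≤ 10 / √(convDen x j : ℝ) := by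
  rw [smoothPartialSum_sub (convDen_pos x j) (convDen_pos x (j + 1)), approxPartialSum_succ_sub,
    ← mul_sub, norm_mul]
  have h := norm_integral_thetaPath_sub_log_le (r := x.convergent j)
    (Nat.cast_le.2 (convDen_le_succ hx j)) (le_abs_sub_convergent hx j)
    (abs_sub_convergent_le hx j)
  rw [show 10 / √(convDen x j : ℝ) = 1 / 2 * (20 / √(convDen x j : ℝ)) by ring]
  refine mul_le_mul (by norm_num) h (norm_nonneg _) (by norm_num)

theorem norm_smoothPartialSum_sub_le {x : ℝ} (hx : Irrational x) {j N : ℕ}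
    (h1 : convDen x j ≤ N) (h2 : N ≤ convDen x (j + 1)) :
    ‖smoothPartialSum x N - smoothPartialSum x (convDen x j)‖ ≤
      ‖approxPartialSum x (j + 1) - approxPartialSum x j‖ + 10 / √(convDen x j : ℝ) := by
  have hj := convDen_pos x j
  have hN : 0 < N := hj.trans_le h1
  have hj' : (0 : ℝ) < convDen x j := Nat.cast_pos.2 hj
  have hN' : (0 : ℝ) < N := Nat.cast_pos.2 hN
  have h1' : (convDen x j : ℝ) ≤ N := Nat.cast_le.2 h1
  have h2' : (N : ℝ) ≤ convDen x (j + 1) := Nat.cast_le.2 h2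
  rw [smoothPartialSum_sub hj hN, approxPartialSum_succ_sub, norm_mul, norm_mul (1 / 2 : ℂ)]
  have h := norm_integral_thetaPath_le (r := x.convergent j) (δ := 1 / (N : ℝ) ^ 2)
    (Nat.cast_le.2 (convDen_le_succ hx j)) (le_abs_sub_convergent hx j)
    (abs_sub_convergent_le hx j) (by gcongr) (one_div_le_one_div_of_le (by positivity)
      (pow_le_pow_left₀ hj'.le h1' 2))
  have e : ‖(1 / 2 : ℂ)‖ = 1 / 2 := by norm_num
  rw [e, show 10 / √(convDen x j : ℝ) = 1 / 2 * (20 / √(convDen x j : ℝ)) by ring, ← mul_add]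
  exact mul_le_mul_of_nonneg_left h (by norm_num)

theorem theorem2 :
    ∃ C : ℝ, ∀ x : ℝ, x ∈ Set.Ico (0 : ℝ) 1 → Irrational x →
      ((∃ s : ℂ, Tendsto (fourierPartialSum x) atTop (𝓝 s)) ↔
        (∃ t : ℂ, Tendsto (approxPartialSum x) atTop (𝓝 t))) ∧
      (∀ s t : ℂ, Tendsto (fourierPartialSum x) atTop (𝓝 s) →
        Tendsto (approxPartialSum x) atTop (𝓝 t) → ‖s - t‖ ≤ C) := by
  -- The sum bounds the accumulated block errors `c`; the `3` bounds the limit `d` of the smoothing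
  -- discrepancy.
  refine ⟨∑' j : ℕ, 10 * (√(Nat.fib (j + 1) : ℝ))⁻¹ + 3, fun x _ hx ↦ ?_⟩
  have hsum := summable_inv_sqrt_fib_succ.mul_left 10
  have hle (j : ℕ) : 10 / √(convDen x j : ℝ) ≤ 10 * (√(Nat.fib (j + 1) : ℝ))⁻¹ := by
    have h1 : (Nat.fib (j + 1) : ℝ) ≤ convDen x j := Nat.cast_le.2 (fib_succ_le_convDen hx j)
    have h2 : (0 : ℝ) < Nat.fib (j + 1) := Nat.cast_pos.2 (Nat.fib_pos.2 j.succ_pos)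
    rw [div_eq_mul_inv]
    have := Real.sqrt_pos.2 h2
    gcongr
  obtain ⟨d, hd, hFd⟩ := exists_tendsto_fourierPartialSum_sub hx
  obtain ⟨c, hc, huc⟩ := exists_tendsto_of_summable_increments hsum
    (w := fun j ↦ smoothPartialSum x (convDen x j) - approxPartialSum x j)
    -- The first denominator is `1`, so the initial integral runs from `1` to `1`.
    (by simp [smoothPartialSum, approxPartialSum, convDen_zero]) fun j ↦ by
      refine le_trans (le_of_eq ?_) ((norm_smoothPartialSum_sub_sub_le hx j).trans (hle j))
      congr 1
      ring
  -- Only this direction needs control inside the blocks; the converse merely samples `N` along the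
  -- denominators.
  have forward {t : ℂ} (ht : Tendsto (approxPartialSum x) atTop (𝓝 t)) :
      Tendsto (fourierPartialSum x) atTop (𝓝 (t + c + d)) := by
    have hu := tendsto_of_tendsto_blocks (tendsto_convDen hx) hsum.tendsto_atTop_zero
      (fun j N h1 h2 ↦ (norm_smoothPartialSum_sub_le hx h1 h2).trans
        (add_le_add_right (hle j) _)) ht huc
    exact (hu.add hFd).congr fun N ↦ by ring
  have backward {s : ℂ} (hs : Tendsto (fourierPartialSum x) atTop (𝓝 s)) :
      Tendsto (approxPartialSum x) atTop (𝓝 (s - d - c)) := by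
    have hu : Tendsto (smoothPartialSum x) atTop (𝓝 (s - d)) :=
      (hs.sub hFd).congr fun N ↦ by ring
    exact ((hu.comp (tendsto_convDen hx)).sub huc).congr fun j ↦ by
      simp only [Function.comp]; ring
  refine ⟨⟨fun ⟨s, hs⟩ ↦ ⟨_, backward hs⟩, fun ⟨t, ht⟩ ↦ ⟨_, forward ht⟩⟩, fun s t hs ht ↦ ?_⟩
  rw [tendsto_nhds_unique hs (forward ht), show t + c + d - t = c + d by ring]
  exact norm_add_le_of_le hc hd
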